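/- Let $I_{22,2}$ be the lattice $\mathbf{Z}^{24}$ with canonical basis $(e_1,\dots,e_{22},f_1,f_2)$ and the diagonal symmetric bilinear form with $e_i^2=1$ and $f_j^2=-1$. Set $u:=e_1+e_2$, $v':=e_1+\cdots+e_{22}-3f_1-3f_2$ and $v:=v'-u$. Let $\Lambda_2:=\langle u,v\rangle\subset I_{22,2}$ and let $\Lambda:=\Lambda_2^\perp$ be its orthogonal complement in $I_{22,2}$ (it is isometric to $2E_8\oplus 2U\oplus 2A_1$). Let $D(\Lambda)=\Lambda^\vee/\Lambda$ be the discriminant group and $\widetilde O(\Lambda):=\operatorname{Ker}(O(\Lambda)\to \operatorname{Aut} D(\Lambda))$ the stable orthogonal group. Restriction to $\Lambda$ identifies the group $$\{g\in O(I_{22,2})\mid g|_{\Lambda_2}=\mathrm{Id}\}$$ with $\widetilde O(\Lambda)\subset O(\Lambda)$; thus $\widetilde O(\Lambda)$ acts on $I_{22,2}$. There exist orthogonal vectors $e,f\in\Lambda$ with $e^2=f^2=2$, $e\cdot\Lambda\subset 2\mathbf{Z}$, $f\cdot\Lambda\subset2\mathbf{Z}$ (that is, generators of the two summands $A_1$ of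 $\Lambda$) such that $\frac12(u+e)$ and $\frac12(v+f)$ lie in $I_{22,2}$. For each such pair $(e,f)$, there is a unique isometric involution $r_I$ of $I_{22,2}$ that exchanges $u$ and $v$, exchanges $e$ and $f$, and is the identity on the orthogonal complement of $\langle e,f\rangle$ in $\Lambda$. Let $d$ be a positive integer with $d\equiv 0,2$ or $4\pmod 8$, and let $\mathcal{O}_d$ be the set of orbits for the action of $\widetilde O(\Lambda)$ on the set of primitive, positive definite, rank-3 sublattices $K\subset I_{22,2}$ of discriminant $d$ (the determinant of a Gram matrix) that contain $\Lambda_2$. Then: a) if $d\equiv 0\pmod 8$, $\mathcal{O}_d$ has exactly one element, and every such $K$ has, in a suitable basis, the Gram matrix $\begin{pmatrix}2&0&0\\0&2&0\\0&0&d/4\end{pmatrix}$; b) if $d\equiv 2\pmod 8$, $\mathcal{O}_d$ has exactly two elements, which are interchanged by the involution $r_I$ (for every choice of $(e,f)$ as above), and every such $K$ has, in a suitable basis, the Gram matrix $\begin{pmatrix}2&0&0\\0&2&1\\0&1&(d+2)/4\end{pmatrix}$; c) if $d\equiv 4\pmod 8$, $\mathcal{O}_d$ has exactly one element, and every such $K$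 has, in a suitable basis, the Gram matrix $\begin{pmatrix}2&0&1\\0&2&1\\1&1&(d+4)/4\end{pmatrix}$. -/

import Mathlib

open scoped Pointwise

namespace GushelMukai

/-! ### Lattices: orthogonal group, discriminant group, stable orthogonal group -/

section Lattice

variable {L : Type*} [AddCommGroup L]

/-- The orthogonal group `O(L)` of a lattice `(L, B)`. -/
def orthogonalGroup (B : LinearMap.BilinForm ℤ L) : Subgroup (L ≃ₗ[ℤ] L) where
  carrier := {g | ∀ x y, B (g x) (g y) = B x y}
  mul_mem' := by
    intro a b ha hb x y
    rw [LinearEquiv.mul_apply, LinearEquiv.mul_apply, ha, hb]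
  one_mem' := by
    intro x y
    rfl
  inv_mem' := by
    intro a ha x y
    have h := ha (a⁻¹ x) (a⁻¹ y)
    rw [← LinearEquiv.mul_apply, ← LinearEquiv.mul_apply, mul_inv_cancel] at h
    exact h.symm

/-- The discriminant group `D(L) = L^∨ / L` of a lattice, where `L^∨ = Hom(L, ℤ)` and `L` is
mapped to `L^∨` by the bilinear form. -/
abbrev DiscriminantGroup (B : LinearMap.BilinForm ℤ L) : Type _ :=
  Module.Dual ℤ L ⧸ LinearMap.range B

/-- An isometry `g` acts on `L^∨` by `φ ↦ φ ∘ g⁻¹`; this preserves the image of `L`. -/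
theorem range_le_comap_dual (B : LinearMap.BilinForm ℤ L) (g : L ≃ₗ[ℤ] L)
    (hg : g ∈ orthogonalGroup B) :
    LinearMap.range B ≤ (LinearMap.range B).comap
      ((g⁻¹ : L ≃ₗ[ℤ] L) : L →ₗ[ℤ] L).dualMap := by
  rintro _ ⟨x, rfl⟩
  refine ⟨g x, ?_⟩
  ext y
  have h := hg x (g⁻¹ y)
  rw [← LinearEquiv.mul_apply, mul_inv_cancel] at h
  exact h

/-- The action of `O(L)` on the discriminant group, `[φ] ↦ [φ ∘ g⁻¹]`. -/
def discriminantAction (B : LinearMap.BilinForm ℤ L) :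
    orthogonalGroup B →* Module.End ℤ (DiscriminantGroup B) where
  toFun g := Submodule.mapQ _ _ (((g : L ≃ₗ[ℤ] L)⁻¹ : L ≃ₗ[ℤ] L) : L →ₗ[ℤ] L).dualMap
    (range_le_comap_dual B g g.2)
  map_one' := by
    ext φ
    rfl
  map_mul' g h := by
    ext φ
    simp only [Subgroup.coe_mul, mul_inv_rev]
    rfl

/-- The stable orthogonal group `Õ(L) = Ker(O(L) → Aut D(L))`. -/
def stableOrthogonalGroup (B : LinearMap.BilinForm ℤ L) : Subgroup (orthogonalGroup B) :=
  (discriminantAction B).ker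

/-- The discriminant of a lattice: the determinant of a Gram matrix. The basis does not matter,
see `discriminant_eq`. -/
noncomputable def discriminant [Module.Free ℤ L] [Module.Finite ℤ L]
    (B : LinearMap.BilinForm ℤ L) : ℤ :=
  (LinearMap.BilinForm.toMatrix (Module.finBasis ℤ L) B).det

theorem discriminant_eq [Module.Free ℤ L] [Module.Finite ℤ L] (B : LinearMap.BilinForm ℤ L)
    {n : ℕ} (b : Module.Basis (Fin n) ℤ L) :
    discriminant B = (LinearMap.BilinForm.toMatrix b B).det := by
  have hn : Module.finrank ℤ L = n := by
    simpa using Module.finrank_eq_card_basis b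
  subst hn
  rw [discriminant, ← LinearMap.BilinForm.toMatrix_mul_basis_toMatrix (b := b)
    (c := Module.finBasis ℤ L), Matrix.det_mul, Matrix.det_mul, Matrix.det_transpose]
  have h : (b.toMatrix (Module.finBasis ℤ L)).det * (b.toMatrix (Module.finBasis ℤ L)).det = 1 := by
    have hu : IsUnit (b.toMatrix (Module.finBasis ℤ L)).det := by
      rw [← Module.Basis.det_apply]
      exact b.isUnit_det _
    rcases Int.isUnit_iff.mp hu with h | h <;> rw [h] <;> norm_num
  linear_combination (LinearMap.BilinForm.toMatrix b B).det * h

/-- `(L, B)` is isometric to the lattice `ℤ³` with Gram matrix `A`. -/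
def HasGramMatrix (B : LinearMap.BilinForm ℤ L) (A : Matrix (Fin 3) (Fin 3) ℤ) : Prop :=
  ∃ b : Module.Basis (Fin 3) ℤ L, LinearMap.BilinForm.toMatrix b B = A

end Lattice

/-! ### The lattice `I_{22,2}` and its sublattices `Λ₂` and `Λ` -/

/-- The underlying group of `I_{22,2}`. -/
abbrev I : Type := Fin 22 ⊕ Fin 2 → ℤ

/-- The bilinear form of `I_{22,2}`: diagonal, with 22 entries `1` and 2 entries `-1`. -/
def form : LinearMap.BilinForm ℤ I :=
  Matrix.toBilin' (Matrix.diagonal (Sum.elim (fun _ => 1) (fun _ => -1)))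

/-- The canonical basis vectors `e_1, …, e_22` (indexed from 0). -/
def eVec (i : Fin 22) : I := Pi.single (Sum.inl i) 1

/-- The canonical basis vectors `f_1, f_2` (indexed from 0). -/
def fVec (j : Fin 2) : I := Pi.single (Sum.inr j) 1

/-- `u = e_1 + e_2`. -/
def u : I := eVec 0 + eVec 1

/-- `v' = e_1 + ⋯ + e_22 - 3 f_1 - 3 f_2`. -/
def v' : I := ∑ i, eVec i - (3 : ℤ) • fVec 0 - (3 : ℤ) • fVec 1

/-- `v = v' - u`. -/
def v : I := v' - u

/-- `Λ₂ = ⟨u, v⟩`. -/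
def Lambda2 : Submodule ℤ I := Submodule.span ℤ {u, v}

/-- `Λ = Λ₂^⊥`, the orthogonal complement in `I_{22,2}`. -/
def Lambda : Submodule ℤ I := form.orthogonal Lambda2

/-- The form of `Λ`. -/
noncomputable def formLambda : LinearMap.BilinForm ℤ Lambda := form.restrict Lambda

/-- The group `{g ∈ O(I_{22,2}) | g|_{Λ₂} = Id}`. -/
def fixGroup : Subgroup (I ≃ₗ[ℤ] I) :=
  orthogonalGroup form ⊓ fixingSubgroup (I ≃ₗ[ℤ] I) (Lambda2 : Set I)

theorem apply_mem_Lambda {g : I ≃ₗ[ℤ] I} (hg : g ∈ fixGroup) {x : I} (hx : x ∈ Lambda) :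
    g x ∈ Lambda := by
  intro y hy
  have h1 : g y = y := (mem_fixingSubgroup_iff (I ≃ₗ[ℤ] I)).mp hg.2 y hy
  have h2 := hg.1 y x
  rw [h1] at h2
  exact h2.trans (hx y hy)

/-- The restriction map `{g ∈ O(I_{22,2}) | g|_{Λ₂} = Id} → O(Λ)`. -/
noncomputable def restrictLambda : fixGroup →* orthogonalGroup formLambda where
  toFun g :=
    ⟨{ toFun := fun x => ⟨(g : I ≃ₗ[ℤ] I) x, apply_mem_Lambda g.2 x.2⟩
       invFun := fun x => ⟨(g : I ≃ₗ[ℤ] I)⁻¹ x, apply_mem_Lambda (fixGroup.inv_mem g.2) x.2⟩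
       map_add' := fun x y => Subtype.ext (map_add (g : I ≃ₗ[ℤ] I) (x : I) (y : I))
       map_smul' := fun c x => Subtype.ext (map_smul (g : I ≃ₗ[ℤ] I) c (x : I))
       left_inv := fun x => Subtype.ext ((g : I ≃ₗ[ℤ] I).symm_apply_apply x)
       right_inv := fun x => Subtype.ext ((g : I ≃ₗ[ℤ] I).apply_symm_apply x) },
      fun x y => g.2.1 x y⟩
  map_one' := rfl
  map_mul' _ _ := rfl

/-! ### The sublattices `K` and their orbits -/

/-- `K ⊂ I_{22,2}` is a primitive (that is, saturated), positive definite sublattice of rank 3 and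
discriminant `d` that contains `Λ₂`. -/
structure IsSpecial (d : ℕ) (K : Submodule ℤ I) : Prop where
  Lambda2_le : Lambda2 ≤ K
  primitive : ∀ (n : ℤ) (x : I), n ≠ 0 → n • x ∈ K → x ∈ K
  posDef : ∀ x ∈ K, x ≠ 0 → 0 < form x x
  rank_eq : Module.finrank ℤ K = 3
  discriminant_eq : discriminant (form.restrict K) = d

/-- The set `𝒪_d` of orbits, under `{g ∈ O(I_{22,2}) | g|_{Λ₂} = Id}` acting by `K ↦ g(K)`, on the
set of the lattices `K` of discriminant `d`. -/
def orbits (d : ℕ) : Set (Set (Submodule ℤ I)) :=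
  {O | ∃ K, IsSpecial d K ∧ O = MulAction.orbit fixGroup K}

/-! ### The involution `r_I` -/

/-- `e` and `f` generate the two summands `A₁` in a decomposition `Λ ≃ 2E₈ ⊕ 2U ⊕ 2A₁`, ordered so
that `(u + e)/2` and `(v + f)/2` lie in `I_{22,2}`. A vector of square 2 and even divisibility in
`Λ` generates an orthogonal direct summand of `Λ`, and the orthogonal complement of two such
orthogonal vectors in `Λ` is even unimodular of signature `(18, 2)`, hence isometric to
`2E₈ ⊕ 2U`. -/
structure IsA1Pair (e f : I) : Prop where
  e_mem : e ∈ Lambda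
  f_mem : f ∈ Lambda
  form_e_e : form e e = 2
  form_f_f : form f f = 2
  form_e_f : form e f = 0
  two_dvd_e : ∀ x ∈ Lambda, 2 ∣ form e x
  two_dvd_f : ∀ x ∈ Lambda, 2 ∣ form f x
  glue_e : ∃ a : I, (2 : ℤ) • a = u + e
  glue_f : ∃ b : I, (2 : ℤ) • b = v + f

/-- `r` is the isometric involution of `I_{22,2}` that extends `r₂ ⊕ r`, where `r₂` exchanges `u`
and `v` in `Λ₂`, and `r` exchanges `e` and `f` and is the identity on the orthogonal complement of
`⟨e, f⟩` in `Λ`. -/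
structure IsRI (e f : I) (r : I ≃ₗ[ℤ] I) : Prop where
  isometry : r ∈ orthogonalGroup form
  involutive : r * r = 1
  map_u : r u = v
  map_v : r v = u
  map_e : r e = f
  map_f : r f = e
  map_perp : ∀ x ∈ Lambda, form e x = 0 → form f x = 0 → r x = x

end GushelMukai

namespace GushelMukai

/-! A primitive `K` of rank 3 containing `Λ₂` is `⟨u, v, y⟩`, where `y` lifts a generator of `K/Λ₂ ≅
ℤ`. As `u² = v² = 2` and `u·v = 0`, translating `y` by `Λ₂` brings `α = u·y` and `β = v·y` into `{0,
1}`, and then `d = 4y² - 2α² - 2β²`. The vector `u + v` is characteristic, so `y² ≡ α + β (mod 2)`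
and `d ≡ 2(α + β) (mod 8)`. Hence `d` fixes `(α, β)` when it is 0 or 4 mod 8 and leaves `(1, 0)` and
`(0, 1)` when it is 2 mod 8. The Gram matrix follows, since `y²` is known.

For fixed `(α, β, d)` there is one orbit, by Eichler's criterion (`exists_apply_eq`): `Λ` contains
two orthogonal hyperbolic planes, and transvections along their isotropic vectors carry one `y` to
any other. The usual condition on classes in `D(Λ)` becomes `y - y' ∈ Λ`, because the vectors are
kept in `I_{22,2}` instead of being projected to `Λ`. Primitivity of `K` and unimodularity supply
the `m ∈ Λ` with `m·y = 1` that the criterion needs. The types `(1, 0)` and `(0, 1)` are not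
equivalent, as `v·K` is even for only one of them, and `r_I` exchanges them because it swaps `u` and
`v`.

The group statements rest on `2 I_{22,2} ⊂ Λ ⊕ Λ₂`: maps are determined, and identities checked,
after doubling. -/

/-! ### The form, its parity, and the projection to `Λ` -/

theorem form_apply (x y : I) :
    form x y = ∑ i, x (Sum.inl i) * y (Sum.inl i) - ∑ j, x (Sum.inr j) * y (Sum.inr j) := by
  simp only [form, Matrix.toBilin'_apply', Matrix.mulVec_diagonal, dotProduct,
    Fintype.sum_sum_type, Sum.elim_inl, Sum.elim_inr]
  rw [sub_eq_add_neg, ← Finset.sum_neg_distrib]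
  congr 1 <;> refine Finset.sum_congr rfl fun i _ => by ring

theorem form_comm (x y : I) : form x y = form y x := by
  simp only [form_apply, mul_comm]

theorem form_u (x : I) : form u x = x (Sum.inl 0) + x (Sum.inl 1) := by
  simp [u, eVec, form_apply, Pi.single_apply]

theorem v_apply_inl (i : Fin 22) : v (Sum.inl i) = if i = 0 ∨ i = 1 then 0 else 1 := by
  revert i
  decide

theorem v_apply_inr (j : Fin 2) : v (Sum.inr j) = -3 := by
  revert j
  decide

theorem form_v (x : I) :
    form v x = ∑ i, x (Sum.inl i) - x (Sum.inl 0) - x (Sum.inl 1)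
      + 3 * ∑ j, x (Sum.inr j) := by
  have h : ∀ i : Fin 22, v (Sum.inl i) * x (Sum.inl i) =
      x (Sum.inl i) - (if i = 0 then x (Sum.inl i) else 0) -
        (if i = 1 then x (Sum.inl i) else 0) := fun i => by
    rw [v_apply_inl]
    by_cases h0 : i = 0
    · simp [h0]
    · by_cases h1 : i = 1 <;> simp [h0, h1]
  simp [form_apply, h, v_apply_inr]
  ring

theorem form_u_u : form u u = 2 := by
  rw [form_u]; decide

theorem form_u_v : form u v = 0 := by
  rw [form_u]; decide

theorem form_v_v : form v v = 2 := by
  rw [form_v]; decide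

/-- The form of `I_{22,2}` is unimodular. -/
theorem exists_form_eq (φ : I →ₗ[ℤ] ℤ) : ∃ y, ∀ x, form y x = φ x := by
  refine ⟨Sum.elim (fun i => φ (Pi.single (Sum.inl i) 1))
    (fun j => -φ (Pi.single (Sum.inr j) 1)), fun x => ?_⟩
  conv_rhs => rw [← LinearMap.sum_single_apply (φ := fun _ => ℤ) x]
  have h : ∀ i, (Pi.single i (x i) : I) = x i • Pi.single i (1 : ℤ) := fun i => by
    rw [← Pi.single_smul, smul_eq_mul, mul_one]
  simp [-zsmul_eq_mul, form_apply, h, mul_comm]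
  ring

theorem mem_Lambda_iff {x : I} : x ∈ Lambda ↔ form u x = 0 ∧ form v x = 0 := by
  constructor
  · intro h
    exact ⟨h u (Submodule.subset_span (by simp)), h v (Submodule.subset_span (by simp))⟩
  · rintro ⟨h1, h2⟩ y hy
    obtain ⟨a, b, rfl⟩ := Submodule.mem_span_pair.mp hy
    simp [-zsmul_eq_mul, h1, h2]

theorem eq_zero_of_form_eq_zero {x : I} (h : ∀ y, form x y = 0) : x = 0 := by
  funext i
  rcases i with i | i
  · simpa [form_apply, Pi.single_apply] using h (Pi.single (Sum.inl i) 1)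
  · simpa [form_apply, Pi.single_apply] using h (Pi.single (Sum.inr i) 1)

/-- `u + v` is a characteristic vector. -/
theorem two_dvd_form_self_sub (x : I) : (2 : ℤ) ∣ form x x - form u x - form v x := by
  have key : ∀ t : ℤ, (2 : ℤ) ∣ t * t - t := fun t => by
    have := (Int.even_mul_pred_self t).two_dvd
    rwa [mul_sub, mul_one] at this
  have h1 : form x x - form u x - form v x = ∑ i, (x (Sum.inl i) * x (Sum.inl i) - x (Sum.inl i))
      - ∑ j, (x (Sum.inr j) * x (Sum.inr j) - x (Sum.inr j)) - 2 * (2 * ∑ j, x (Sum.inr j)) := by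
    rw [form_u, form_v, form_apply, Finset.sum_sub_distrib, Finset.sum_sub_distrib]
    ring
  rw [h1]
  exact ((Finset.dvd_sum fun i _ => key _).sub (Finset.dvd_sum fun i _ => key _)).sub
    (dvd_mul_right _ _)

/-- Vectors of `Λ` are orthogonal to the characteristic vector `u + v`. Evenness makes `a²/2` an
integer in the transvections below. -/
theorem two_dvd_form_self {x : I} (hx : x ∈ Lambda) : (2 : ℤ) ∣ form x x := by
  have h := two_dvd_form_self_sub x
  rwa [(mem_Lambda_iff.mp hx).1, (mem_Lambda_iff.mp hx).2, sub_zero, sub_zero] at h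

/-- Twice the orthogonal projection to `Λ`. -/
def twiceProj : I →ₗ[ℤ] I :=
  (2 : ℤ) • LinearMap.id - (form u).smulRight u - (form v).smulRight v

theorem twiceProj_apply (x : I) : twiceProj x = (2 : ℤ) • x - form u x • u - form v x • v := by
  simp [twiceProj]

theorem twiceProj_mem (x : I) : twiceProj x ∈ Lambda := by
  rw [mem_Lambda_iff, twiceProj_apply]
  simp [-zsmul_eq_mul, form_u_u, form_v_v, form_u_v, form_comm v u, mul_comm]

theorem form_twiceProj_left (x : I) {m : I} (hm : m ∈ Lambda) :
    form (twiceProj x) m = 2 * form x m := by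
  obtain ⟨h1, h2⟩ := mem_Lambda_iff.mp hm
  simp [-zsmul_eq_mul, twiceProj_apply, h1, h2]

/-- The form of `Λ` is nondegenerate. -/
theorem eq_zero_of_form_Lambda {x : I} (hx : x ∈ Lambda) (h : ∀ m ∈ Lambda, form x m = 0) :
    x = 0 := by
  refine eq_zero_of_form_eq_zero fun y => ?_
  have h1 := form_twiceProj_left y hx
  rw [form_comm, h _ (twiceProj_mem y), form_comm] at h1
  omega

/-! ### Restriction to `Λ` and the stable orthogonal group -/

theorem mem_fixGroup_iff {g : I ≃ₗ[ℤ] I} :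
    g ∈ fixGroup ↔ (∀ x y, form (g x) (g y) = form x y) ∧ g u = u ∧ g v = v := by
  rw [fixGroup, Subgroup.mem_inf, mem_fixingSubgroup_iff]
  refine and_congr Iff.rfl ⟨fun h => ⟨h u (Submodule.subset_span (by simp)),
    h v (Submodule.subset_span (by simp))⟩, ?_⟩
  rintro ⟨h1, h2⟩ y hy
  obtain ⟨a, b, rfl⟩ := Submodule.mem_span_pair.mp hy
  rw [LinearEquiv.smul_def, map_add, map_smul, map_smul, h1, h2]

theorem smul_two_injective {x y : I} (h : (2 : ℤ) • x = (2 : ℤ) • y) : x = y :=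
  smul_right_injective I (two_ne_zero : (2 : ℤ) ≠ 0) h

theorem two_smul_eq (x : I) : (2 : ℤ) • x = twiceProj x + form u x • u + form v x • v := by
  rw [twiceProj_apply]
  abel

theorem restrictLambda_injective : Function.Injective restrictLambda := by
  rw [injective_iff_map_eq_one]
  intro g hg
  obtain ⟨-, hu, hv⟩ := mem_fixGroup_iff.mp g.2
  have h1 : ∀ x ∈ Lambda, (g : I ≃ₗ[ℤ] I) x = x := fun x hx => by
    have := congrArg (fun h : orthogonalGroup formLambda => ((h : Lambda ≃ₗ[ℤ] Lambda) ⟨x, hx⟩ : I)) hg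
    exact this
  refine Subtype.ext (LinearEquiv.ext fun x => smul_two_injective ?_)
  rw [← map_smul, two_smul_eq, map_add, map_add, map_smul, map_smul, hu, hv,
    h1 _ (twiceProj_mem x)]
  exact (two_smul_eq x).symm

theorem form_eVec (i : Fin 22) (x : I) : form (eVec i) x = x (Sum.inl i) := by
  simp [form_apply, eVec, Pi.single_apply]

/-- A projection of `I_{22,2}` onto `Λ`. -/
theorem exists_projection : ∃ p : I →ₗ[ℤ] Lambda, ∀ x : Lambda, p x = x := by
  -- `eVec 0` and `eVec 2` have pairings `(1, 0)` and `(0, 1)` with `(u, v)`, so no denominator 2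
  -- appears, unlike for the orthogonal projection.
  have h : ∀ x, (LinearMap.id - (form u).smulRight (eVec 0) - (form v).smulRight (eVec 2) :
      I →ₗ[ℤ] I) x ∈ Lambda := by
    intro x
    have h1 : form u (eVec 0) = 1 := by rw [form_u]; decide
    have h2 : form u (eVec 2) = 0 := by rw [form_u]; decide
    have h3 : form v (eVec 0) = 0 := by rw [form_v]; decide
    have h4 : form v (eVec 2) = 1 := by rw [form_v]; decide
    rw [mem_Lambda_iff]
    simp [-zsmul_eq_mul, h1, h2, h3, h4]
  refine ⟨LinearMap.codRestrict Lambda _ h, fun x => Subtype.ext ?_⟩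
  obtain ⟨h1, h2⟩ := mem_Lambda_iff.mp x.2
  simp [-zsmul_eq_mul, h1, h2]

/-- Every functional on `Λ` is the pairing with a vector of `I_{22,2}`. -/
theorem exists_form_eq_on_Lambda (φ : Lambda →ₗ[ℤ] ℤ) :
    ∃ y, ∀ m : Lambda, form y m = φ m := by
  obtain ⟨p, hp⟩ := exists_projection
  obtain ⟨y, hy⟩ := exists_form_eq (φ ∘ₗ p)
  exact ⟨y, fun m => by rw [hy, LinearMap.comp_apply, hp]⟩

theorem mem_stableOrthogonalGroup_iff {L : Type*} [AddCommGroup L] {B : LinearMap.BilinForm ℤ L}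
    {h : orthogonalGroup B} : h ∈ stableOrthogonalGroup B ↔
      ∀ φ : Module.Dual ℤ L, ∃ z, ∀ m, B z m = φ ((h : L ≃ₗ[ℤ] L)⁻¹ m) - φ m := by
  have key : ∀ φ : Module.Dual ℤ L, discriminantAction B h (Submodule.Quotient.mk φ) =
      Submodule.Quotient.mk φ ↔
        ∃ z, ∀ m, B z m = φ ((h : L ≃ₗ[ℤ] L)⁻¹ m) - φ m := fun φ => by
    refine (Submodule.Quotient.eq _).trans (exists_congr fun z => ?_)
    exact LinearMap.ext_iff
  rw [stableOrthogonalGroup, MonoidHom.mem_ker]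
  constructor
  · intro hh φ
    rw [← key, hh]
    rfl
  · intro hh
    refine LinearMap.ext fun x => ?_
    obtain ⟨φ, rfl⟩ := Submodule.Quotient.mk_surjective _ x
    rw [(key φ).mpr (hh φ)]
    rfl

theorem form_apply_left {g : I ≃ₗ[ℤ] I} (hg : g ∈ fixGroup) (x y : I) :
    form (g x) y = form x (g⁻¹ y) := by
  have h := (mem_fixGroup_iff.mp hg).1 x (g⁻¹ y)
  rwa [← LinearEquiv.mul_apply, mul_inv_cancel] at h

/-- If `φ` is the pairing with `y ∈ I_{22,2}`, then `φ ∘ g⁻¹ - φ` is the pairing with `g y - y`,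
which lies in `Λ` because `g` fixes `u` and `v`. -/
theorem restrictLambda_mem_stable (g : fixGroup) :
    restrictLambda g ∈ stableOrthogonalGroup formLambda := by
  rw [mem_stableOrthogonalGroup_iff]
  intro φ
  obtain ⟨y, hy⟩ := exists_form_eq_on_Lambda φ
  obtain ⟨hg, hu, hv⟩ := mem_fixGroup_iff.mp g.2
  have hz : (g : I ≃ₗ[ℤ] I) y - y ∈ Lambda := by
    have h1 := hg u y
    have h2 := hg v y
    rw [hu] at h1
    rw [hv] at h2
    rw [mem_Lambda_iff, map_sub, map_sub, h1, h2]
    simp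
  refine ⟨⟨_, hz⟩, fun m => ?_⟩
  rw [← hy, ← hy]
  change form ((g : I ≃ₗ[ℤ] I) y - y) m = form y ((g : I ≃ₗ[ℤ] I)⁻¹ m) - form y m
  rw [map_sub, LinearMap.sub_apply, form_apply_left g.2]

/-- For a stable isometry `h` of `Λ`, the map `Id ⊕ h` of `Λ₂ ⊕ Λ` extends to `I_{22,2}`. -/
theorem exists_extension (h : orthogonalGroup formLambda)
    (hh : h ∈ stableOrthogonalGroup formLambda) :
    ∃ G : I →ₗ[ℤ] I, ∀ x, (2 : ℤ) • G x =
      (h : Lambda ≃ₗ[ℤ] Lambda) ⟨twiceProj x, twiceProj_mem x⟩ + form u x • u + form v x • v := by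
  rw [mem_stableOrthogonalGroup_iff] at hh
  have key : ∀ x, ∃ y : I, (2 : ℤ) • y = (h : Lambda ≃ₗ[ℤ] Lambda) ⟨twiceProj x, twiceProj_mem x⟩
      + form u x • u + form v x • v := by
    intro x
    -- Stability applied to the functional `x·` gives `z ∈ Λ` with `h(p) - p = 2z` for `p =
    -- twiceProj x`; hence `x + z` is the required half.
    obtain ⟨z, hz⟩ := hh ((form x).comp Lambda.subtype)
    set w := (h : Lambda ≃ₗ[ℤ] Lambda) ⟨twiceProj x, twiceProj_mem x⟩ with hw
    have h0 : (w : I) - twiceProj x - (2 : ℤ) • (z : I) = 0 := by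
      refine eq_zero_of_form_Lambda (Lambda.sub_mem (Lambda.sub_mem w.2 (twiceProj_mem x))
        (Lambda.smul_mem _ z.2)) fun m hm => ?_
      have h1 : form z m = form x ((h : Lambda ≃ₗ[ℤ] Lambda)⁻¹ ⟨m, hm⟩) - form x m := hz ⟨m, hm⟩
      have h2 : form w m = form (twiceProj x) ((h : Lambda ≃ₗ[ℤ] Lambda)⁻¹ ⟨m, hm⟩) := by
        have := h.2 ⟨twiceProj x, twiceProj_mem x⟩ ((h : Lambda ≃ₗ[ℤ] Lambda)⁻¹ ⟨m, hm⟩)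
        rw [← LinearEquiv.mul_apply (h : Lambda ≃ₗ[ℤ] Lambda) _ ⟨m, hm⟩, mul_inv_cancel] at this
        exact this
      rw [form_twiceProj_left _ (Subtype.prop _)] at h2
      simp only [map_sub, map_smul, LinearMap.sub_apply, LinearMap.smul_apply, smul_eq_mul, h1, h2,
        form_twiceProj_left x hm]
      ring
    refine ⟨x + z, ?_⟩
    rw [smul_add, two_smul_eq, sub_eq_iff_eq_add.mp (sub_eq_zero.mp h0)]
    abel
  choose G hG using key
  refine ⟨{ toFun := G, map_add' := fun x y => ?_, map_smul' := fun c x => ?_ }, hG⟩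
  · refine smul_two_injective ?_
    have : (⟨twiceProj (x + y), twiceProj_mem (x + y)⟩ : Lambda) =
        ⟨twiceProj x, twiceProj_mem x⟩ + ⟨twiceProj y, twiceProj_mem y⟩ :=
      Subtype.ext (map_add _ _ _)
    rw [smul_add, hG, hG, hG, this, map_add, map_add, map_add, add_smul, add_smul,
      Submodule.coe_add]
    abel
  · refine smul_two_injective ?_
    have : (⟨twiceProj (c • x), twiceProj_mem (c • x)⟩ : Lambda) =
        c • ⟨twiceProj x, twiceProj_mem x⟩ := Subtype.ext (map_smul _ _ _)
    rw [RingHom.id_apply, smul_comm (2 : ℤ) c, hG, hG, this, map_smul, map_smul, map_smul,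
      Submodule.coe_smul, smul_eq_mul, smul_eq_mul, mul_smul, mul_smul, smul_add, smul_add]

theorem twiceProj_add {x : I} (hx : x ∈ Lambda) (a b : ℤ) :
    twiceProj (x + a • u + b • v) = (2 : ℤ) • x := by
  obtain ⟨h1, h2⟩ := mem_Lambda_iff.mp hx
  simp only [twiceProj_apply, map_add, map_smul, form_u_u, form_u_v, form_comm v u, form_v_v, h1,
    h2]
  module

theorem extension_comp {h k : orthogonalGroup formLambda} (hk : h * k = 1) {G H : I →ₗ[ℤ] I}
    (hG : ∀ x, (2 : ℤ) • G x =
      (h : Lambda ≃ₗ[ℤ] Lambda) ⟨twiceProj x, twiceProj_mem x⟩ + form u x • u + form v x • v)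
    (hH : ∀ x, (2 : ℤ) • H x =
      (k : Lambda ≃ₗ[ℤ] Lambda) ⟨twiceProj x, twiceProj_mem x⟩ + form u x • u + form v x • v)
    (x : I) : G (H x) = x := by
  -- `G` and `H` are each known only after doubling, so the composite needs a factor 4.
  refine smul_two_injective (smul_two_injective ?_)
  set w := (k : Lambda ≃ₗ[ℤ] Lambda) ⟨twiceProj x, twiceProj_mem x⟩ with hw
  obtain ⟨h1, h2⟩ := mem_Lambda_iff.mp w.2
  have h3 : (h : Lambda ≃ₗ[ℤ] Lambda) w = ⟨twiceProj x, twiceProj_mem x⟩ := by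
    have := congrArg (fun g : orthogonalGroup formLambda => (g : Lambda ≃ₗ[ℤ] Lambda)
      ⟨twiceProj x, twiceProj_mem x⟩) hk
    exact this
  have h4 : (⟨twiceProj (w + form u x • u + form v x • v), twiceProj_mem _⟩ : Lambda)
      = (2 : ℤ) • w := Subtype.ext (twiceProj_add w.2 _ _)
  have h5 : (2 : ℤ) • H x = w + form u x • u + form v x • v := hH x
  rw [← map_smul, h5, hG, h4, map_smul, h3, two_smul_eq]
  simp only [map_add, map_smul, form_u_u, form_u_v, form_comm v u, form_v_v, h1, h2, smul_eq_mul,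
    Submodule.coe_smul]
  module

theorem restrictLambda_range :
    restrictLambda.range = stableOrthogonalGroup formLambda := by
  refine le_antisymm ?_ fun h hh => ?_
  · rintro _ ⟨g, rfl⟩
    exact restrictLambda_mem_stable g
  obtain ⟨G, hG⟩ := exists_extension h hh
  obtain ⟨H, hH⟩ := exists_extension h⁻¹ (inv_mem hh)
  let g : I ≃ₗ[ℤ] I := { G with
    invFun := H
    left_inv := extension_comp (inv_mul_cancel h) hH hG
    right_inv := extension_comp (mul_inv_cancel h) hG hH }
  have hgG : ∀ x, (2 : ℤ) • g x =
    (h : Lambda ≃ₗ[ℤ] Lambda) ⟨twiceProj x, twiceProj_mem x⟩ + form u x • u + form v x • v := hG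
  have htu : (⟨twiceProj u, twiceProj_mem u⟩ : Lambda) = 0 := Subtype.ext ((twiceProj_apply u).trans <| by
    rw [form_u_u, form_comm v u, form_u_v]; simp)
  have htv : (⟨twiceProj v, twiceProj_mem v⟩ : Lambda) = 0 := Subtype.ext ((twiceProj_apply v).trans <| by
    rw [form_v_v, form_u_v]; simp)
  have hg : g ∈ fixGroup := by
    rw [mem_fixGroup_iff]
    refine ⟨fun x y => ?_, smul_two_injective ?_, smul_two_injective ?_⟩
    · have h1 : form ((2 : ℤ) • g x) ((2 : ℤ) • g y) = form ((2 : ℤ) • x) ((2 : ℤ) • y) := by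
        rw [hgG, hgG, two_smul_eq, two_smul_eq]
        have h2 : form ((h : Lambda ≃ₗ[ℤ] Lambda) ⟨twiceProj x, twiceProj_mem x⟩)
          ((h : Lambda ≃ₗ[ℤ] Lambda) ⟨twiceProj y, twiceProj_mem y⟩) =
            form (twiceProj x) (twiceProj y) := h.2 _ _
        have key : ∀ a ∈ Lambda, form a u = 0 ∧ form a v = 0 ∧ form u a = 0 ∧ form v a = 0 :=
          fun a ha => by
            rw [form_comm a u, form_comm a v]
            exact ⟨(mem_Lambda_iff.mp ha).1, (mem_Lambda_iff.mp ha).2, mem_Lambda_iff.mp ha⟩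
        simp only [map_add, map_smul, LinearMap.add_apply, LinearMap.smul_apply, h2, key,
          Subtype.prop, twiceProj_mem]
      simp only [map_smul, LinearMap.smul_apply, smul_eq_mul] at h1
      omega
    · rw [hgG, htu, map_zero, form_u_u, form_comm v u, form_u_v]
      simp
    · rw [hgG, htv, map_zero, form_v_v, form_u_v]
      simp
  refine ⟨⟨g, hg⟩, Subtype.ext (LinearEquiv.ext fun x => Subtype.ext (smul_two_injective ?_))⟩
  change (2 : ℤ) • g x = (2 : ℤ) • ((h : Lambda ≃ₗ[ℤ] Lambda) x : I)
  obtain ⟨h1, h2⟩ := mem_Lambda_iff.mp x.2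
  have h3 : (⟨twiceProj x, twiceProj_mem x⟩ : Lambda) = (2 : ℤ) • x :=
    Subtype.ext ((twiceProj_apply x).trans <| by rw [h1, h2]; simp)
  rw [hgG, h3, map_smul, h1, h2, zero_smul, zero_smul, add_zero, add_zero, Submodule.coe_smul]

/-! ### The involution `r_I` -/

/-- The two halves are `eVec 0` and `eVec 2`. On `Λ = ⟨u, v⟩^⊥` the vectors `e` and `f` pair like `2
eVec 0` and `2 eVec 2`, hence evenly. -/
theorem isA1Pair_eVec : IsA1Pair (eVec 0 - eVec 1) ((2 : ℤ) • eVec 2 - v) := by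
  have h0 : ∀ i : Fin 22, form v (eVec i) = if i = 0 ∨ i = 1 then 0 else 1 := fun i => by
    rw [form_comm, form_eVec, v_apply_inl]
  have h1 : form u (eVec 0) = 1 := by rw [form_u]; decide
  have h1' : form u (eVec 1) = 1 := by rw [form_u]; decide
  have h2 : form u (eVec 2) = 0 := by rw [form_u]; decide
  have h3 : ∀ i j : Fin 22, form (eVec i) (eVec j) = if i = j then 1 else 0 := fun i j => by
    rw [form_eVec, eVec, Pi.single_apply]
    simp
  refine ⟨?_, ?_, ?_, ?_, ?_, fun x hx => ?_, fun x hx => ?_, ⟨eVec 0, ?_⟩, ⟨eVec 2, ?_⟩⟩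
  · rw [mem_Lambda_iff]
    simp [h0, h1, h1']
  · rw [mem_Lambda_iff]
    simp [-zsmul_eq_mul, h0, h2, form_u_v, form_v_v]
  · simp [h3]
  · simp [-zsmul_eq_mul, h3, h0, form_comm _ v, form_v_v]
  · simp [-zsmul_eq_mul, h3, h0, form_comm _ v]
  · have h4 := (mem_Lambda_iff.mp hx).1
    rw [form_u] at h4
    rw [map_sub, LinearMap.sub_apply, form_eVec, form_eVec]
    omega
  · rw [map_sub, LinearMap.sub_apply, (mem_Lambda_iff.mp hx).2, map_smul, LinearMap.smul_apply,
      sub_zero]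
    exact dvd_mul_right _ _
  · rw [u]
    module
  · module

/-- The product of the reflections in two orthogonal vectors `p`, `q` of square 2. -/
def reflProd (p q : I) : I →ₗ[ℤ] I :=
  LinearMap.id - (form p).smulRight p - (form q).smulRight q

theorem reflProd_apply (p q x : I) : reflProd p q x = x - form p x • p - form q x • q := by
  simp [reflProd]

theorem reflProd_reflProd {p q : I} (hp : form p p = 2) (hq : form q q = 2) (hpq : form p q = 0)
    (x : I) : reflProd p q (reflProd p q x) = x := by
  simp only [reflProd_apply, map_sub, map_smul, hp, hq, hpq, form_comm q p]
  module

theorem form_reflProd {p q : I} (hp : form p p = 2) (hq : form q q = 2) (hpq : form p q = 0)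
    (x y : I) : form (reflProd p q x) (reflProd p q y) = form x y := by
  simp only [reflProd_apply, map_sub, map_smul, LinearMap.sub_apply, LinearMap.smul_apply, hp, hq,
    hpq, form_comm q p, smul_eq_mul, form_comm x p, form_comm x q]
  ring

/-- Over `ℚ`, `r_I` is `-1` on `⟨u - v, e - f⟩` and `1` on its complement. That plane is spanned by
`p = (u + e - v - f)/2` and `q = (u - e - v + f)/2`, which are integral by the glue conditions,
orthogonal and of square 2. So `r_I` is the product of their reflections. -/
theorem IsA1Pair.exists_isRI {e f : I} (h : IsA1Pair e f) : ∃ r, IsRI e f r := by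
  obtain ⟨a, ha⟩ := h.glue_e
  obtain ⟨b, hb⟩ := h.glue_f
  obtain ⟨hue, hve⟩ := mem_Lambda_iff.mp h.e_mem
  obtain ⟨huf, hvf⟩ := mem_Lambda_iff.mp h.f_mem
  have hee := h.form_e_e
  have hff := h.form_f_f
  have hef := h.form_e_f
  have hfe := form_comm f e
  have hvu := form_comm v u
  have he : e = (2 : ℤ) • a - u := by rw [ha]; abel
  have hf : f = (2 : ℤ) • b - v := by rw [hb]; abel
  -- pairings with `2 (a - b)` and `2 (a' - b')`
  have hP : ∀ x, 2 * form (a - b) x = form u x + form e x - form v x - form f x := fun x => by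
    rw [he, hf]
    simp only [map_sub, map_smul, LinearMap.sub_apply, LinearMap.smul_apply, smul_eq_mul]
    ring
  have hQ : ∀ x, 2 * form (a - e - (b - f)) x = form u x - form e x - form v x + form f x :=
    fun x => by
      rw [he, hf]
      simp only [map_sub, map_smul, LinearMap.sub_apply, LinearMap.smul_apply, smul_eq_mul]
      ring
  have hP' : ∀ x, 2 * form x (a - b) = form u x + form e x - form v x - form f x := fun x => by
    rw [form_comm, hP]
  have hQ' : ∀ x, 2 * form x (a - e - (b - f)) = form u x - form e x - form v x + form f x :=
    fun x => by rw [form_comm, hQ]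
  set p := a - b with hp
  set q := a - e - (b - f) with hq
  have h2p : (2 : ℤ) • p = u + e - v - f := by rw [hp, he, hf]; module
  have h2q : (2 : ℤ) • q = u - e - v + f := by rw [hq, he, hf]; module
  have huv := form_u_v
  have huu := form_u_u
  have hvv := form_v_v
  have heu := form_comm e u
  have hev := form_comm e v
  have hfu := form_comm f u
  have hfv := form_comm f v
  have hpp : form p p = 2 := by
    linarith [hP p, hP' u, hP' e, hP' v, hP' f]
  have hqq : form q q = 2 := by
    linarith [hQ q, hQ' u, hQ' e, hQ' v, hQ' f]
  have hpq : form p q = 0 := by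
    linarith [hP q, hQ' u, hQ' e, hQ' v, hQ' f]
  let r : I ≃ₗ[ℤ] I := { reflProd p q with
    invFun := reflProd p q
    left_inv := reflProd_reflProd hpp hqq hpq
    right_inv := reflProd_reflProd hpp hqq hpq }
  have hr : ∀ x s t, form p x = s → form q x = t → r x = x - s • p - t • q := by
    rintro x _ _ rfl rfl
    exact reflProd_apply p q x
  refine ⟨r, form_reflProd hpp hqq hpq, LinearEquiv.ext (reflProd_reflProd hpp hqq hpq), ?_, ?_,
    ?_, ?_, fun x hx hex hfx => ?_⟩
  · rw [hr u 1 1 (by linarith [hP u]) (by linarith [hQ u])]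
    refine smul_two_injective ?_
    rw [one_smul, one_smul, smul_sub, smul_sub, h2p, h2q]
    module
  · rw [hr v (-1) (-1) (by linarith [hP v]) (by linarith [hQ v])]
    refine smul_two_injective ?_
    rw [neg_one_smul, neg_one_smul, smul_sub, smul_sub, smul_neg, smul_neg, h2p, h2q]
    module
  · rw [hr e 1 (-1) (by linarith [hP e]) (by linarith [hQ e])]
    refine smul_two_injective ?_
    rw [one_smul, neg_one_smul, smul_sub, smul_sub, smul_neg, h2p, h2q]
    module
  · rw [hr f (-1) 1 (by linarith [hP f]) (by linarith [hQ f])]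
    refine smul_two_injective ?_
    rw [one_smul, neg_one_smul, smul_sub, smul_sub, smul_neg, h2p, h2q]
    module
  · obtain ⟨h1, h2⟩ := mem_Lambda_iff.mp hx
    rw [hr x 0 0 (by linarith [hP x]) (by linarith [hQ x])]
    simp

/-- Since `e² = f² = 2`, every `2x` is a combination of `u, v, e, f` plus a vector of `⟨e, f⟩^⊥ ∩
Λ`, where the map is prescribed. -/
theorem IsA1Pair.isRI_unique {e f : I} (h : IsA1Pair e f) {r s : I ≃ₗ[ℤ] I} (hr : IsRI e f r)
    (hs : IsRI e f s) : r = s := by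
  obtain ⟨hue, hve⟩ := mem_Lambda_iff.mp h.e_mem
  obtain ⟨huf, hvf⟩ := mem_Lambda_iff.mp h.f_mem
  refine LinearEquiv.ext fun x => smul_two_injective ?_
  set w := twiceProj x - form e x • e - form f x • f with hw
  have hwm : w ∈ Lambda := Lambda.sub_mem (Lambda.sub_mem (twiceProj_mem x)
    (Lambda.smul_mem _ h.e_mem)) (Lambda.smul_mem _ h.f_mem)
  have h1 : form e w = 0 := by
    simp only [hw, twiceProj_apply, map_sub, map_smul, h.form_e_e, h.form_e_f, form_comm e u,
      form_comm e v, hue, hve, smul_eq_mul]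
    ring
  have h2 : form f w = 0 := by
    simp only [hw, twiceProj_apply, map_sub, map_smul, h.form_f_f, h.form_e_f, form_comm f u,
      form_comm f v, form_comm f e, huf, hvf, smul_eq_mul]
    ring
  have h3 : (2 : ℤ) • x = w + form e x • e + form f x • f + form u x • u + form v x • v := by
    rw [two_smul_eq, hw]
    abel
  rw [← map_smul, ← map_smul, h3]
  simp only [map_add, map_smul, hr.map_u, hr.map_v, hr.map_e, hr.map_f, hs.map_u, hs.map_v,
    hs.map_e, hs.map_f, hr.map_perp w hwm h1 h2, hs.map_perp w hwm h1 h2]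

/-! ### Eichler transvections and Eichler's criterion -/

/-- The Eichler transvection attached to an isotropic vector `e` and a vector `a ⊥ e` with
`a² = 2c`. -/
def transvection (e a : I) (c : ℤ) : I →ₗ[ℤ] I :=
  LinearMap.id - (form e).smulRight a + (form a).smulRight e - c • (form e).smulRight e

theorem transvection_apply (e a : I) (c : ℤ) (x : I) :
    transvection e a c x = x - form e x • a + form a x • e - (c * form e x) • e := by
  simp [transvection, mul_smul]

theorem transvection_neg {e a : I} {c : ℤ} (he : form e e = 0) (hea : form e a = 0)
    (hc : form a a = 2 * c) (x : I) : transvection e (-a) c (transvection e a c x) = x := by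
  simp only [transvection_apply, map_sub, map_add, map_neg, map_smul, LinearMap.neg_apply, he, hea,
    hc, form_comm a e]
  module

theorem form_transvection {e a : I} {c : ℤ} (he : form e e = 0) (hea : form e a = 0)
    (hc : form a a = 2 * c) (x y : I) :
    form (transvection e a c x) (transvection e a c y) = form x y := by
  simp only [transvection_apply, map_sub, map_add, map_smul, LinearMap.sub_apply,
    LinearMap.add_apply, LinearMap.smul_apply, he, hea, hc, form_comm a e, form_comm x e,
    form_comm x a, smul_eq_mul]
  ring

theorem exists_transvection {e a : I} {c : ℤ} (heL : e ∈ Lambda) (haL : a ∈ Lambda)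
    (he : form e e = 0) (hea : form e a = 0) (hc : form a a = 2 * c) :
    ∃ g ∈ fixGroup, ∀ x, g x = x - form e x • a + form a x • e - (c * form e x) • e := by
  have h := transvection_neg (a := -a) (c := c) he (by rw [map_neg, hea, neg_zero])
    (by rw [map_neg, map_neg, LinearMap.neg_apply, neg_neg, hc])
  rw [neg_neg] at h
  refine ⟨{ transvection e a c with
    invFun := transvection e (-a) c
    left_inv := transvection_neg he hea hc
    right_inv := h }, ?_, transvection_apply e a c⟩
  rw [mem_fixGroup_iff]
  obtain ⟨h1, h2⟩ := mem_Lambda_iff.mp heL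
  obtain ⟨h3, h4⟩ := mem_Lambda_iff.mp haL
  refine ⟨form_transvection he hea hc, (transvection_apply e a c u).trans ?_,
    (transvection_apply e a c v).trans ?_⟩
  · simp [form_comm _ u, h1, h3]
  · simp [form_comm _ v, h2, h4]

/-- `e`, `f` span a hyperbolic plane in `Λ`. -/
structure IsHyperbolicPair (e f : I) : Prop where
  left_mem : e ∈ Lambda
  right_mem : f ∈ Lambda
  form_left : form e e = 0
  form_right : form f f = 0
  form_left_right : form e f = 1

/-- `e, f` and `e', f'` span two orthogonal hyperbolic planes in `Λ`. -/
structure IsHyperbolicQuadruple (e f e' f' : I) : Prop where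
  left : IsHyperbolicPair e f
  right : IsHyperbolicPair e' f'
  form_left_left : form e e' = 0
  form_left_right : form e f' = 0
  form_right_left : form f e' = 0
  form_right_right : form f f' = 0

theorem IsHyperbolicPair.swap {e f : I} (h : IsHyperbolicPair e f) : IsHyperbolicPair f e :=
  ⟨h.right_mem, h.left_mem, h.form_right, h.form_left, by rw [form_comm, h.form_left_right]⟩

theorem IsHyperbolicQuadruple.swap_left {e f e' f' : I} (h : IsHyperbolicQuadruple e f e' f') :
    IsHyperbolicQuadruple f e e' f' :=
  ⟨h.left.swap, h.right, h.form_right_left, h.form_right_right, h.form_left_left,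
    h.form_left_right⟩

theorem IsHyperbolicQuadruple.swap_right {e f e' f' : I} (h : IsHyperbolicQuadruple e f e' f') :
    IsHyperbolicQuadruple e f f' e' :=
  ⟨h.left, h.right.swap, h.form_left_right, h.form_left_left, h.form_right_right,
    h.form_right_left⟩

/-- The elementary operation on the coordinates in two hyperbolic planes. -/
theorem IsHyperbolicQuadruple.exists_elementary {e f e' f' : I}
    (h : IsHyperbolicQuadruple e f e' f') (k : ℤ) (y : I) : ∃ g ∈ fixGroup,
      form e (g y) = form e y ∧ form e' (g y) = form e' y ∧
      form f (g y) = form f y + k * form e' y ∧ form f' (g y) = form f' y - k * form e y := by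
  obtain ⟨g, hg, hgx⟩ := exists_transvection (e := e) (a := k • e') (c := 0) h.left.left_mem
    (Lambda.smul_mem k h.right.left_mem) h.left.form_left (by simp [-zsmul_eq_mul, h.form_left_left])
    (by simp [-zsmul_eq_mul, h.right.form_left])
  refine ⟨g, hg, ?_⟩
  rw [hgx]
  simp only [map_add, map_sub, map_smul, LinearMap.smul_apply, smul_eq_mul, h.left.form_left,
    h.form_left_left, h.right.form_left, form_comm e' e, form_comm f e, h.left.form_left_right,
    h.form_right_left, form_comm f' e', h.right.form_left_right, form_comm f' e,
    h.form_left_right]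
  refine ⟨?_, ?_, ?_, ?_⟩ <;> ring

/-- Euclidean descent on `|e·y|`. If `e·y` divides `e'·y` and `f'·y`, elementary operations clear
both; otherwise a nonzero remainder is used to replace `e·y` by something smaller. -/
theorem IsHyperbolicQuadruple.exists_orthogonal_of_ne_zero {e f e' f' : I}
    (h : IsHyperbolicQuadruple e f e' f') (n : ℕ) : ∀ y, form e y ≠ 0 → (form e y).natAbs = n →
      ∃ g ∈ fixGroup, form e' (g y) = 0 ∧ form f' (g y) = 0 := by
  induction n using Nat.strong_induction_on with
  | _ n ih =>
    intro y hy hn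
    -- a remainder modulo `e·y` in the second plane makes `e·y` smaller
    have descend : ∀ s : ℤ, ¬ form e y ∣ s → ∀ z, form e z = form e y →
        (∀ k, ∃ g ∈ fixGroup, form e (g z) = form e z + k * (s % form e y)) →
        (∃ g ∈ fixGroup, z = g y) → ∃ g ∈ fixGroup, form e' (g y) = 0 ∧ form f' (g y) = 0 := by
      rintro s hs z hz hk ⟨g₁, hg₁, rfl⟩
      have hr0 : 0 < s % form e y := lt_of_le_of_ne (Int.emod_nonneg _ hy)
        fun h0 => hs (Int.dvd_of_emod_eq_zero h0.symm)
      have hr1 : s % form e y < |form e y| := Int.emod_lt_abs _ hy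
      set t := s % form e y with ht
      -- The shift by 1 puts the new `e·y` in `1, …, t` rather than `0, …, t - 1`, so it stays
      -- nonzero.
      obtain ⟨g₂, hg₂, hg₂y⟩ := hk (-((form e y - 1) / t))
      have h1 : form e (g₂ (g₁ y)) = (form e y - 1) % t + 1 := by
        rw [hg₂y, hz]
        linarith [Int.mul_ediv_add_emod (form e y - 1) t]
      have h2 : 0 ≤ (form e y - 1) % t := Int.emod_nonneg _ hr0.ne'
      have h3 : (form e y - 1) % t < t := Int.emod_lt_of_pos _ hr0
      have h5 : 0 < form e (g₂ (g₁ y)) := by rw [h1]; linarith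
      have h6 : form e (g₂ (g₁ y)) < |form e y| := by rw [h1]; linarith
      rw [Int.abs_eq_natAbs] at h6
      obtain ⟨g₃, hg₃, h4⟩ := ih (form e (g₂ (g₁ y))).natAbs (by omega) (g₂ (g₁ y)) h5.ne' rfl
      exact ⟨g₃ * g₂ * g₁, mul_mem (mul_mem hg₃ hg₂) hg₁, h4⟩
    by_cases h1 : form e y ∣ form e' y
    · by_cases h2 : form e y ∣ form f' y
      · obtain ⟨k, hk⟩ := h1
        obtain ⟨l, hl⟩ := h2
        obtain ⟨g₁, hg₁, h11, h12, -, h14⟩ := h.swap_right.exists_elementary k y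
        obtain ⟨g₂, hg₂, -, h22, -, h24⟩ := h.exists_elementary l (g₁ y)
        refine ⟨g₂ * g₁, mul_mem hg₂ hg₁, ?_⟩
        rw [LinearEquiv.mul_apply, h22, h24, h11, h12, h14, hk, hl]
        constructor <;> ring
      · obtain ⟨g₁, hg₁, h11, h12, -, h14⟩ := h.exists_elementary (form f' y / form e y) y
        refine descend _ h2 (g₁ y) h11 (fun k => ?_) ⟨g₁, hg₁, rfl⟩
        obtain ⟨g₂, hg₂, -, -, h23, -⟩ :=
          h.swap_left.swap_right.exists_elementary k (g₁ y)
        refine ⟨g₂, hg₂, ?_⟩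
        rw [h23, h14, Int.emod_def, mul_comm (form e y)]
    · obtain ⟨g₁, hg₁, h11, h12, -, h14⟩ :=
        h.swap_right.exists_elementary (form e' y / form e y) y
      refine descend _ h1 (g₁ y) h11 (fun k => ?_) ⟨g₁, hg₁, rfl⟩
      obtain ⟨g₂, hg₂, -, -, h23, -⟩ := h.swap_left.exists_elementary k (g₁ y)
      refine ⟨g₂, hg₂, ?_⟩
      rw [h23, h14, Int.emod_def, mul_comm (form e y)]

/-- If `e·y = 0`, one operation first adds a nonzero `e'·y` or `f'·y` to it. -/
theorem IsHyperbolicQuadruple.exists_orthogonal {e f e' f' : I}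
    (h : IsHyperbolicQuadruple e f e' f') (y : I) :
    ∃ g ∈ fixGroup, form e' (g y) = 0 ∧ form f' (g y) = 0 := by
  by_cases h0 : form e y = 0
  · by_cases h1 : form e' y = 0
    · by_cases h2 : form f' y = 0
      · exact ⟨1, one_mem _, h1, h2⟩
      · obtain ⟨g₁, hg₁, -, -, h3, -⟩ := h.swap_left.swap_right.exists_elementary 1 y
        obtain ⟨g₂, hg₂, h4⟩ := h.exists_orthogonal_of_ne_zero _ (g₁ y)
          (by rwa [h3, h0, zero_add, one_mul]) rfl
        exact ⟨g₂ * g₁, mul_mem hg₂ hg₁, h4⟩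
    · obtain ⟨g₁, hg₁, -, -, h3, -⟩ := h.swap_left.exists_elementary 1 y
      obtain ⟨g₂, hg₂, h4⟩ := h.exists_orthogonal_of_ne_zero _ (g₁ y)
        (by rwa [h3, h0, zero_add, one_mul]) rfl
      exact ⟨g₂ * g₁, mul_mem hg₂ hg₁, h4⟩
  · exact h.exists_orthogonal_of_ne_zero _ y h0 rfl

/-- A vector that is orthogonal to a hyperbolic plane `⟨e, f⟩` and pairs to `1` with some vector
of `Λ` is equivalent to its translate by `e`. -/
theorem IsHyperbolicPair.exists_add {e f : I} (h : IsHyperbolicPair e f) {y m : I}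
    (he : form e y = 0) (hf : form f y = 0) (hm : m ∈ Lambda) (hmy : form m y = 1) :
    ∃ g ∈ fixGroup, g y = y + e := by
  -- Removing the component of `m` in the plane makes `a ⊥ e` and keeps `a·y = 1`; the transvection
  -- then adds exactly `e` to `y`.
  set a := m - form f m • e - form e m • f with ha
  have haL : a ∈ Lambda := Lambda.sub_mem (Lambda.sub_mem hm (Lambda.smul_mem _ h.left_mem))
    (Lambda.smul_mem _ h.right_mem)
  have hea : form e a = 0 := by
    simp only [ha, map_sub, map_smul, h.form_left, h.form_left_right, smul_eq_mul]
    ring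
  have hay : form a y = 1 := by
    simp only [ha, map_sub, map_smul, LinearMap.sub_apply, LinearMap.smul_apply, he, hf, hmy,
      smul_eq_mul]
    ring
  obtain ⟨c, hc⟩ := two_dvd_form_self haL
  obtain ⟨g, hg, hgx⟩ := exists_transvection h.left_mem haL h.form_left hea hc
  refine ⟨g, hg, ?_⟩
  rw [hgx, he, hay]
  module

/-- **Eichler's criterion**: two vectors of the same square, with the same pairings with `u` and
`v`, that pair to `1` with some vector of `Λ`, are equivalent. -/
theorem IsHyperbolicQuadruple.exists_apply_eq {e f e' f' : I}
    (h : IsHyperbolicQuadruple e f e' f') {y y' m m' : I} (hm : m ∈ Lambda) (hmy : form m y = 1)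
    (hm' : m' ∈ Lambda) (hmy' : form m' y' = 1) (hu : form u y = form u y')
    (hv : form v y = form v y') (hyy : form y y = form y' y') : ∃ g ∈ fixGroup, g y = y' := by
  -- Once `y` is orthogonal to the second plane, `e'` can be added to it within the orbit. The
  -- result pairs to 1 with `f'`, so a transvection along `f'` can subtract any `z ∈ Λ` orthogonal
  -- to that plane, up to a multiple of `f'`.
  have key : ∀ {y m : I}, m ∈ Lambda → form m y = 1 → ∃ g ∈ fixGroup,
      form e' (g y) = 0 ∧ form f' (g y) = 0 ∧ ∃ g' ∈ fixGroup, g' y = g y + e' := by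
    intro y m hm hmy
    obtain ⟨g, hg, h1, h2⟩ := h.exists_orthogonal y
    obtain ⟨g', hg', h3⟩ := h.right.exists_add h1 h2 (apply_mem_Lambda hg hm)
      (by rw [(mem_fixGroup_iff.mp hg).1, hmy])
    exact ⟨g, hg, h1, h2, g' * g, mul_mem hg' hg, h3⟩
  obtain ⟨g, hg, h1, h2, k, hk, hky⟩ := key hm hmy
  obtain ⟨g', hg', h1', h2', k', hk', hky'⟩ := key hm' hmy'
  obtain ⟨hgi, hgu, hgv⟩ := mem_fixGroup_iff.mp hg
  obtain ⟨hgi', hgu', hgv'⟩ := mem_fixGroup_iff.mp hg'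
  set z := g y - g' y' with hz
  have hzL : z ∈ Lambda := by
    rw [mem_Lambda_iff, hz, map_sub, map_sub]
    have a1 := hgi u y
    have a2 := hgi v y
    have a3 := hgi' u y'
    have a4 := hgi' v y'
    rw [hgu] at a1
    rw [hgv] at a2
    rw [hgu'] at a3
    rw [hgv'] at a4
    constructor <;> linarith
  have hfz : form f' z = 0 := by rw [hz, map_sub, h2, h2', sub_zero]
  obtain ⟨c, hc⟩ := two_dvd_form_self hzL
  obtain ⟨t, ht, htx⟩ := exists_transvection h.right.right_mem hzL h.right.form_right hfz hc
  have h3 : form f' e' = 1 := by rw [form_comm, h.right.form_left_right]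
  have h4 : form z e' = 0 := by
    rw [form_comm, hz, map_sub, h1, h1', sub_zero]
  -- Equality of the squares of `g y` and `g' y'` makes the coefficient of `f'` in the transvection
  -- vanish.
  have h5 : form z z = 2 * (form z (g y)) := by
    have b1 := hgi y y
    have b2 := hgi' y' y'
    rw [hz]
    simp only [map_sub, LinearMap.sub_apply, form_comm (g y) (g' y')]
    linarith
  have h6 : t (g y + e') = g' y' + e' := by
    have h7 : c = form z (g y) := by linarith
    rw [htx, map_add, map_add, h2, h3, h4, ← h7, hz]
    module
  refine ⟨k'⁻¹ * t * k, mul_mem (mul_mem (inv_mem hk') ht) hk, ?_⟩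
  rw [LinearEquiv.mul_apply, LinearEquiv.mul_apply, hky, h6, ← hky', ← LinearEquiv.mul_apply,
    inv_mul_cancel]
  rfl

/-! ### Two orthogonal hyperbolic planes in `Λ` -/

/-- The isotropic vectors `3 f_j - Σ_{i ∈ s} e_i`. -/
def isotropic (j : Fin 2) (s : Finset (Fin 22)) : I :=
  (3 : ℤ) • fVec j - ∑ i ∈ s, eVec i

theorem form_isotropic (j : Fin 2) (s : Finset (Fin 22)) (x : I) :
    form (isotropic j s) x = -(3 * x (Sum.inr j)) - ∑ i ∈ s, x (Sum.inl i) := by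
  have h : form (fVec j) x = -x (Sum.inr j) := by
    simp [form_apply, fVec, Pi.single_apply]
  simp [-zsmul_eq_mul, isotropic, h, form_eVec]

theorem isotropic_inl (j : Fin 2) (s : Finset (Fin 22)) (i : Fin 22) :
    isotropic j s (Sum.inl i) = if i ∈ s then -1 else 0 := by
  simp only [isotropic, fVec, eVec, Pi.sub_apply, Pi.smul_apply, Finset.sum_apply, Pi.single_apply]
  by_cases h : i ∈ s <;> simp [h]

theorem isotropic_inr (j : Fin 2) (s : Finset (Fin 22)) (j' : Fin 2) :
    isotropic j s (Sum.inr j') = if j' = j then 3 else 0 := by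
  simp only [isotropic, fVec, eVec, Pi.sub_apply, Pi.smul_apply, Finset.sum_apply, Pi.single_apply]
  by_cases h : j' = j <;> simp [h]

theorem form_isotropic_isotropic (j j' : Fin 2) (s s' : Finset (Fin 22)) :
    form (isotropic j s) (isotropic j' s') = (s ∩ s').card - if j = j' then 9 else 0 := by
  simp only [form_isotropic, isotropic_inl, isotropic_inr, Finset.sum_ite_mem, Finset.sum_const]
  by_cases h : j = j' <;> simp [h] ; ring

/-- Nine indices balance the coefficient 3 twice: against `-3 f_j` in `v`, and in the square `9 -
3²`. -/
theorem isotropic_mem {s : Finset (Fin 22)} (h0 : 0 ∉ s) (h1 : 1 ∉ s) (hs : s.card = 9)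
    (j : Fin 2) : isotropic j s ∈ Lambda := by
  rw [mem_Lambda_iff, form_u, form_v]
  simp [isotropic_inl, isotropic_inr, h0, h1, hs]

theorem isHyperbolicPair_isotropic {s t : Finset (Fin 22)} (hs0 : 0 ∉ s) (hs1 : 1 ∉ s)
    (hs : s.card = 9) (ht0 : 0 ∉ t) (ht1 : 1 ∉ t) (ht : t.card = 9) (hst : (s ∩ t).card = 8)
    (j : Fin 2) : IsHyperbolicPair (isotropic j s) (-isotropic j t) :=
  ⟨isotropic_mem hs0 hs1 hs j, Lambda.neg_mem (isotropic_mem ht0 ht1 ht j),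
    by simp [form_isotropic_isotropic, hs], by simp [form_isotropic_isotropic, ht],
    by simp [form_isotropic_isotropic, hst]⟩

/-- Within a plane the index sets share eight elements, giving the product `-(8 - 9) = 1`; between
planes both the index sets and the `f_j` are disjoint. -/
theorem isHyperbolicQuadruple_isotropic :
    IsHyperbolicQuadruple (isotropic 0 (Finset.Icc 2 10)) (-isotropic 0 (Finset.Icc 3 11))
      (isotropic 1 (Finset.Icc 12 20)) (-isotropic 1 (Finset.Icc 13 21)) := by
  refine ⟨isHyperbolicPair_isotropic ?_ ?_ ?_ ?_ ?_ ?_ ?_ 0,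
    isHyperbolicPair_isotropic ?_ ?_ ?_ ?_ ?_ ?_ ?_ 1, ?_, ?_, ?_, ?_⟩
  on_goal 15 =>
    have h : (Finset.Icc 2 10 ∩ Finset.Icc 12 20 : Finset (Fin 22)).card = 0 := by decide
    simp [form_isotropic_isotropic, h]
  on_goal 15 =>
    have h : (Finset.Icc 2 10 ∩ Finset.Icc 13 21 : Finset (Fin 22)).card = 0 := by decide
    simp [form_isotropic_isotropic, h]
  on_goal 15 =>
    have h : (Finset.Icc 3 11 ∩ Finset.Icc 12 20 : Finset (Fin 22)).card = 0 := by decide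
    simp [form_isotropic_isotropic, h]
  on_goal 15 =>
    have h : (Finset.Icc 3 11 ∩ Finset.Icc 13 21 : Finset (Fin 22)).card = 0 := by decide
    simp [form_isotropic_isotropic, h]
  all_goals decide

/-! ### The lattices `K` and their glue vectors -/

/-- The lattice `⟨u, v, y⟩`. -/
def extendBy (y : I) : Submodule ℤ I := Submodule.span ℤ {u, v, y}

theorem mem_extendBy {x y : I} : x ∈ extendBy y ↔ ∃ a b c : ℤ, a • u + b • v + c • y = x :=
  Submodule.mem_span_triple

theorem self_mem_extendBy (y : I) : y ∈ extendBy y := Submodule.subset_span (by simp)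

theorem Lambda2_le_extendBy (y : I) : Lambda2 ≤ extendBy y :=
  Submodule.span_mono (by rintro _ (rfl | rfl) <;> simp)

theorem smul_extendBy (g : I ≃ₗ[ℤ] I) (y : I) :
    g • extendBy y = Submodule.span ℤ {g u, g v, g y} := by
  rw [extendBy, Submodule.smul_span]
  simp only [Set.smul_set_insert, Set.smul_set_singleton, LinearEquiv.smul_def]

/-- `y` has pairings `α`, `β` with `u`, `v`, it completes `u`, `v` to a basis of a primitive
sublattice, and the discriminant of this sublattice is `d`. -/
structure IsGlueVector (α β d : ℤ) (y : I) : Prop where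
  form_u : form u y = α
  form_v : form v y = β
  disc : 4 * form y y - 2 * α ^ 2 - 2 * β ^ 2 = d
  exists_mem : ∃ m ∈ Lambda, form m y = 1

theorem smul_u_add_smul_v_apply (a b : ℤ) :
    (a • u + b • v) (Sum.inl 0) = a ∧ (a • u + b • v) (Sum.inl 2) = b := by
  have h1 : u (Sum.inl 0) = 1 := by decide
  have h2 : u (Sum.inl 2) = 0 := by decide
  simp only [Pi.add_apply, Pi.smul_apply, h1, h2, v_apply_inl]
  simp

theorem eq_zero_of_smul_u_add_smul_v {a b : ℤ} (h : a • u + b • v = 0) : a = 0 ∧ b = 0 := by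
  have := smul_u_add_smul_v_apply a b
  rw [h] at this
  exact ⟨this.1.symm, this.2.symm⟩

theorem mem_Lambda2_of_smul_mem {n : ℤ} {x : I} (hn : n ≠ 0) (h : n • x ∈ Lambda2) :
    x ∈ Lambda2 := by
  obtain ⟨a, b, hab⟩ := Submodule.mem_span_pair.mp h
  obtain ⟨h1, h2⟩ := smul_u_add_smul_v_apply a b
  rw [hab] at h1 h2
  refine Submodule.mem_span_pair.mpr ⟨x (Sum.inl 0), x (Sum.inl 2), smul_right_injective I hn ?_⟩
  simp only
  rw [← hab, ← h1, ← h2, smul_add, smul_smul, smul_smul]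
  rfl

/-- Pairing with `m` reads off the coefficient of `y`, which gives independence and primitivity. -/
theorem form_eq_of_mem_Lambda {m y : I} (hm : m ∈ Lambda) (hmy : form m y = 1) (a b c : ℤ) :
    form m (a • u + b • v + c • y) = c := by
  obtain ⟨h1, h2⟩ := mem_Lambda_iff.mp hm
  simp only [map_add, map_smul, form_comm m u, form_comm m v, h1, h2, hmy, smul_eq_mul]
  ring

theorem IsGlueVector.eq_zero {α β d : ℤ} {y : I} (h : IsGlueVector α β d y) {a b c : ℤ}
    (h0 : a • u + b • v + c • y = 0) : a = 0 ∧ b = 0 ∧ c = 0 := by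
  obtain ⟨m, hm, hmy⟩ := h.exists_mem
  have hc := form_eq_of_mem_Lambda hm hmy a b c
  rw [h0, map_zero] at hc
  subst hc
  rw [zero_smul, add_zero] at h0
  exact ⟨(eq_zero_of_smul_u_add_smul_v h0).1, (eq_zero_of_smul_u_add_smul_v h0).2, rfl⟩

theorem exists_basis_span_triple {x y z : I} (h : ∀ a b c : ℤ, a • x + b • y + c • z = 0 →
    a = 0 ∧ b = 0 ∧ c = 0) : ∃ b : Module.Basis (Fin 3) ℤ (Submodule.span ℤ {x, y, z}),
      ∀ i, (b i : I) = ![x, y, z] i := by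
  have hli : LinearIndependent ℤ ![x, y, z] := by
    rw [Fintype.linearIndependent_iff]
    intro g hg
    rw [Fin.sum_univ_three] at hg
    obtain ⟨h0, h1, h2⟩ := h _ _ _ hg
    intro i
    fin_cases i <;> assumption
  have hs : Submodule.span ℤ (Set.range ![x, y, z]) = Submodule.span ℤ {x, y, z} := by
    congr 1
    ext t
    simp [or_comm, or_left_comm]
  refine ⟨(Module.Basis.span hli).map (LinearEquiv.ofEq _ _ hs), fun i => ?_⟩
  simp [Module.Basis.span_apply]

theorem hasGramMatrix_span_triple {x y z : I} (h : ∀ a b c : ℤ, a • x + b • y + c • z = 0 →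
    a = 0 ∧ b = 0 ∧ c = 0) : HasGramMatrix (form.restrict (Submodule.span ℤ {x, y, z}))
      !![form x x, form x y, form x z; form x y, form y y, form y z;
        form x z, form y z, form z z] := by
  obtain ⟨b, hb⟩ := exists_basis_span_triple h
  refine ⟨b, ?_⟩
  ext i j
  rw [LinearMap.BilinForm.toMatrix_apply]
  change form (b i) (b j) = _
  rw [hb, hb]
  fin_cases i <;> fin_cases j <;> simp [form_comm y x, form_comm z x, form_comm z y]

theorem IsGlueVector.hasGramMatrix {α β d : ℤ} {y : I} (h : IsGlueVector α β d y) :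
    HasGramMatrix (form.restrict (extendBy y)) !![2, 0, α; 0, 2, β; α, β, form y y] := by
  have := hasGramMatrix_span_triple (x := u) (y := v) (z := y) fun _ _ _ => h.eq_zero
  rwa [form_u_u, form_u_v, form_v_v, h.form_u, h.form_v] at this

theorem IsGlueVector.hasGramMatrix_swap {α β d : ℤ} {y : I} (h : IsGlueVector α β d y) :
    HasGramMatrix (form.restrict (extendBy y)) !![2, 0, β; 0, 2, α; β, α, form y y] := by
  have := hasGramMatrix_span_triple (x := v) (y := u) (z := y) fun a b c h0 => by
    rw [add_comm (a • v)] at h0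
    obtain ⟨h1, h2, h3⟩ := h.eq_zero h0
    exact ⟨h2, h1, h3⟩
  rw [form_u_u, form_comm v u, form_u_v, form_v_v, h.form_u, h.form_v, Set.insert_comm] at this
  exact this

theorem discriminant_eq_det_of_hasGramMatrix {L : Type*} [AddCommGroup L] [Module.Free ℤ L]
    [Module.Finite ℤ L] {B : LinearMap.BilinForm ℤ L} {A : Matrix (Fin 3) (Fin 3) ℤ}
    (h : HasGramMatrix B A) : discriminant B = A.det := by
  obtain ⟨b, rfl⟩ := h
  exact discriminant_eq B b

theorem IsGlueVector.isSpecial {α β : ℤ} {d : ℕ} {y : I} (hd : 0 < d)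
    (h : IsGlueVector α β d y) : IsSpecial d (extendBy y) := by
  obtain ⟨m, hm, hmy⟩ := h.exists_mem
  refine ⟨Lambda2_le_extendBy y, fun n x hn hx => ?_, fun x hx hx0 => ?_, ?_, ?_⟩
  · obtain ⟨a, b, c, habc⟩ := mem_extendBy.mp hx
    have hc := form_eq_of_mem_Lambda hm hmy a b c
    rw [habc, map_smul, smul_eq_mul] at hc
    have h1 : x - form m x • y ∈ Lambda2 := mem_Lambda2_of_smul_mem hn
      (Submodule.mem_span_pair.mpr ⟨a, b, by
        rw [smul_sub, smul_smul, hc, ← habc, add_sub_cancel_right]⟩)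
    rw [← sub_add_cancel x (form m x • y)]
    exact add_mem (Lambda2_le_extendBy y h1) (Submodule.smul_mem _ _ (self_mem_extendBy y))
  · obtain ⟨a, b, c, rfl⟩ := mem_extendBy.mp hx
    -- Completing the squares in `a` and `b` leaves `d` as the coefficient of `c²`.
    have h1 : 4 * form (a • u + b • v + c • y) (a • u + b • v + c • y) =
        2 * (2 * a + c * α) ^ 2 + 2 * (2 * b + c * β) ^ 2 + c ^ 2 * d := by
      rw [← h.disc]
      simp only [map_add, map_smul, LinearMap.add_apply, LinearMap.smul_apply, form_u_u, form_u_v,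
        form_comm v u, form_v_v, form_comm y u, form_comm y v, h.form_u, h.form_v, smul_eq_mul]
      ring
    have hd' : (0 : ℤ) < d := by exact_mod_cast hd
    by_cases hc : c = 0
    · subst hc
      have h2 : a ≠ 0 ∨ b ≠ 0 := by
        by_contra! h3
        exact hx0 (by rw [h3.1, h3.2]; simp)
      rcases h2 with h2 | h2 <;> have := sq_pos_of_ne_zero h2 <;> nlinarith [sq_nonneg a, sq_nonneg b]
    · have := mul_pos (sq_pos_of_ne_zero hc) hd'
      nlinarith [sq_nonneg (2 * a + c * α), sq_nonneg (2 * b + c * β)]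
  · obtain ⟨b, -⟩ := h.hasGramMatrix
    simpa using Module.finrank_eq_card_basis b
  · rw [discriminant_eq_det_of_hasGramMatrix h.hasGramMatrix, ← h.disc, Matrix.det_fin_three]
    simp
    ring

/-! ### From a lattice `K` to a glue vector -/

theorem finrank_Lambda2 : Module.finrank ℤ Lambda2 = 2 := by
  have hli : LinearIndependent ℤ ![u, v] := by
    rw [LinearIndependent.pair_iff]
    exact fun a b h => eq_zero_of_smul_u_add_smul_v h
  have h := finrank_span_eq_card hli
  rwa [Matrix.range_cons, Matrix.range_cons, Matrix.range_empty, Set.union_empty,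
    Set.singleton_union, Fintype.card_fin] at h

theorem isTorsionFree_quotient {M : Type*} [AddCommGroup M] {N : Submodule ℤ M}
    (hN : ∀ (n : ℤ) (x : M), n ≠ 0 → n • x ∈ N → x ∈ N) : Module.IsTorsionFree ℤ (M ⧸ N) := by
  refine Module.IsTorsionFree.of_smul_eq_zero fun n x hx => ?_
  obtain ⟨x, rfl⟩ := N.mkQ_surjective x
  rw [← map_smul, Submodule.mkQ_apply, Submodule.Quotient.mk_eq_zero] at hx
  rw [Submodule.mkQ_apply, Submodule.Quotient.mk_eq_zero]
  exact or_iff_not_imp_left.mpr fun hn => hN n x hn hx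

/-- A primitive sublattice of `I_{22,2}` is a direct summand, so that its functionals extend. -/
theorem exists_functional_extension {K : Submodule ℤ I}
    (hK : ∀ (n : ℤ) (x : I), n ≠ 0 → n • x ∈ K → x ∈ K) (ψ : K →ₗ[ℤ] ℤ) :
    ∃ φ : I →ₗ[ℤ] ℤ, ∀ x : K, φ x = ψ x := by
  have : Module.IsTorsionFree ℤ (I ⧸ K) := isTorsionFree_quotient hK
  obtain ⟨s, hs⟩ := Module.projective_lifting_property K.mkQ LinearMap.id K.mkQ_surjective
  have hp : ∀ x, (LinearMap.id - s ∘ₗ K.mkQ : I →ₗ[ℤ] I) x ∈ K := fun x => by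
    have h := LinearMap.congr_fun hs (K.mkQ x)
    rw [← Submodule.Quotient.mk_eq_zero K, ← Submodule.mkQ_apply, LinearMap.sub_apply, map_sub]
    exact sub_eq_zero.mpr h.symm
  refine ⟨ψ ∘ₗ LinearMap.codRestrict K _ hp, fun x => congrArg ψ (Subtype.ext ?_)⟩
  have hx : K.mkQ (x : I) = 0 := by simp
  simp [hx]

/-- `K/Λ₂` is torsion-free of rank 1, hence isomorphic to `ℤ`; `φ` is the quotient map. -/
theorem IsSpecial.exists_functional {d : ℕ} {K : Submodule ℤ I} (h : IsSpecial d K) :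
    ∃ (φ : K →ₗ[ℤ] ℤ) (y : K), φ y = 1 ∧ ∀ x : K, φ x = 0 ↔ (x : I) ∈ Lambda2 := by
  set N : Submodule ℤ K := Lambda2.comap K.subtype with hN
  have : Module.IsTorsionFree ℤ (K ⧸ N) :=
    isTorsionFree_quotient fun n x hn hx => mem_Lambda2_of_smul_mem hn hx
  have hfr : Module.finrank ℤ (K ⧸ N) = Module.finrank ℤ ℤ := by
    have h1 := Submodule.finrank_quotient_add_finrank N
    have h2 := (Submodule.comapSubtypeEquivOfLe h.Lambda2_le).finrank_eq
    rw [h.rank_eq, h2, finrank_Lambda2] at h1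
    rw [Module.finrank_self]
    omega
  let E := LinearEquiv.ofFinrankEq (K ⧸ N) ℤ hfr
  obtain ⟨y, hy⟩ := N.mkQ_surjective (E.symm 1)
  refine ⟨E.toLinearMap ∘ₗ N.mkQ, y, by simp [hy], fun x => ?_⟩
  simp [hN]

/-- The functional `K → K/Λ₂ ≅ ℤ` extends to `I_{22,2}` by primitivity and is the pairing with some
`m` by unimodularity. It kills `u` and `v`, so `m ∈ Λ`. -/
theorem IsSpecial.exists_isGlueVector {d : ℕ} {K : Submodule ℤ I} (h : IsSpecial d K) :
    ∃ α β y, (α = 0 ∨ α = 1) ∧ (β = 0 ∨ β = 1) ∧ IsGlueVector α β d y ∧ K = extendBy y := by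
  obtain ⟨ψ, y₀, hy₀, hker⟩ := h.exists_functional
  obtain ⟨φ, hφ⟩ := exists_functional_extension h.primitive ψ
  obtain ⟨m, hm⟩ := exists_form_eq φ
  have huK : u ∈ K := h.Lambda2_le (Submodule.subset_span (by simp))
  have hvK : v ∈ K := h.Lambda2_le (Submodule.subset_span (by simp))
  have hmψ : ∀ x : K, form m x = ψ x := fun x => (hm x).trans (hφ x)
  have hmu : form m u = 0 :=
    (hmψ ⟨u, huK⟩).trans ((hker _).mpr (Submodule.subset_span (by simp)))
  have hmv : form m v = 0 :=
    (hmψ ⟨v, hvK⟩).trans ((hker _).mpr (Submodule.subset_span (by simp)))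
  have hmL : m ∈ Lambda := by
    rw [mem_Lambda_iff, form_comm u, form_comm v]
    exact ⟨hmu, hmv⟩
  set a := form u y₀ / 2 with ha
  set b := form v y₀ / 2 with hb
  set y : I := y₀ - a • u - b • v with hy
  have hyK : y ∈ K := K.sub_mem (K.sub_mem y₀.2 (K.smul_mem _ huK)) (K.smul_mem _ hvK)
  have hmy : form m y = 1 := by
    rw [hy, map_sub, map_sub, map_smul, map_smul, hmu, hmv, hmψ, hy₀]
    simp
  have hyu : form u y = form u y₀ % 2 := by
    rw [hy, map_sub, map_sub, map_smul, map_smul, form_u_u, form_u_v, smul_eq_mul, smul_eq_mul]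
    omega
  have hyv : form v y = form v y₀ % 2 := by
    rw [hy, map_sub, map_sub, map_smul, map_smul, form_v_v, form_comm v u, form_u_v, smul_eq_mul,
      smul_eq_mul]
    omega
  have hK : K = extendBy y := by
    refine le_antisymm (fun x hx => ?_) ?_
    · have h1 : x - form m x • y ∈ Lambda2 := by
        have h2 : x - form m x • y ∈ K := K.sub_mem hx (K.smul_mem _ hyK)
        refine (hker ⟨_, h2⟩).mp ?_
        rw [← hmψ]
        change form m (x - form m x • y) = 0
        rw [map_sub, map_smul, hmy, smul_eq_mul, mul_one, sub_self]
      rw [← sub_add_cancel x (form m x • y)]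
      exact add_mem (Lambda2_le_extendBy y h1) (Submodule.smul_mem _ _ (self_mem_extendBy y))
    · rw [extendBy, Submodule.span_le]
      rintro _ (rfl | rfl | rfl)
      exacts [huK, hvK, hyK]
  have hg : IsGlueVector (form u y) (form v y) (4 * form y y - 2 * form u y ^ 2 -
    2 * form v y ^ 2) y := ⟨rfl, rfl, rfl, m, hmL, hmy⟩
  refine ⟨form u y, form v y, y, by omega, by omega, ⟨rfl, rfl, ?_, m, hmL, hmy⟩, hK⟩
  have h' : IsSpecial d (extendBy y) := by rwa [← hK]
  rw [← h'.discriminant_eq, discriminant_eq_det_of_hasGramMatrix hg.hasGramMatrix, Matrix.det_fin_three]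
  simp
  ring

/-- The discriminant modulo 8 determines the glue, up to exchanging `u` and `v`. -/
theorem IsGlueVector.emod_eight {α β d : ℤ} {y : I} (h : IsGlueVector α β d y)
    (hα : α = 0 ∨ α = 1) (hβ : β = 0 ∨ β = 1) :
    d % 8 = 0 ∧ α = 0 ∧ β = 0 ∨
      d % 8 = 2 ∧ (α = 1 ∧ β = 0 ∨ α = 0 ∧ β = 1) ∨ d % 8 = 4 ∧ α = 1 ∧ β = 1 := by
  have h1 := two_dvd_form_self_sub y
  have h2 := h.disc
  rw [h.form_u, h.form_v] at h1
  rcases hα with rfl | rfl <;> rcases hβ with rfl | rfl <;> norm_num at h2 <;> omega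

theorem exists_isGlueVector {α β d : ℤ} (hα : α = 0 ∨ α = 1) (hβ : β = 0 ∨ β = 1)
    (hd : d % 8 = 2 * (α + β)) : ∃ y, IsGlueVector α β d y := by
  set e := isotropic 1 (Finset.Icc 12 20) with he
  set f := -isotropic 1 (Finset.Icc 13 21) with hf
  have hef : IsHyperbolicPair e f := isHyperbolicQuadruple_isotropic.right
  obtain ⟨heu, hev⟩ := mem_Lambda_iff.mp hef.left_mem
  obtain ⟨hfu, hfv⟩ := mem_Lambda_iff.mp hef.right_mem
  have hxu : form u (α • eVec 0 + β • eVec 2) = α := by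
    rw [form_u]
    simp [eVec]
  have hxv : form v (α • eVec 0 + β • eVec 2) = β := by
    rw [map_add, map_smul, map_smul, form_comm, form_eVec, form_comm, form_eVec, v_apply_inl,
      v_apply_inl]
    simp
  have hxx : form (α • eVec 0 + β • eVec 2) (α • eVec 0 + β • eVec 2) = α ^ 2 + β ^ 2 := by
    simp only [map_add, map_smul, LinearMap.add_apply, LinearMap.smul_apply, form_eVec]
    simp [eVec]
    ring
  have h0 : (0 : Fin 22) ∉ Finset.Icc (12 : Fin 22) 20 := by decide
  have h2 : (2 : Fin 22) ∉ Finset.Icc (12 : Fin 22) 20 := by decide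
  have h0' : (0 : Fin 22) ∉ Finset.Icc (13 : Fin 22) 21 := by decide
  have h2' : (2 : Fin 22) ∉ Finset.Icc (13 : Fin 22) 21 := by decide
  have hxe : form (α • eVec 0 + β • eVec 2) e = 0 := by
    rw [map_add, map_smul, map_smul, LinearMap.add_apply, LinearMap.smul_apply,
      LinearMap.smul_apply, form_eVec, form_eVec, he, isotropic_inl, isotropic_inl, if_neg h0,
      if_neg h2]
    simp
  have hxf : form (α • eVec 0 + β • eVec 2) f = 0 := by
    rw [map_add, map_smul, map_smul, LinearMap.add_apply, LinearMap.smul_apply,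
      LinearMap.smul_apply, form_eVec, form_eVec, hf, Pi.neg_apply, Pi.neg_apply, isotropic_inl,
      isotropic_inl, if_neg h0', if_neg h2']
    simp
  set x := α • eVec 0 + β • eVec 2 with hx
  -- `x` carries the glue and has square `α + β`; the hyperbolic part adds `2(d/8)` to the square,
  -- so the discriminant is `2(α + β) + 8(d/8) = d`. The summand `e` gives `f·y = 1`.
  refine ⟨x + e + (d / 8) • f, ?_, ?_, ?_, f, hef.right_mem, ?_⟩
  · rw [map_add, map_add, map_smul, hxu, heu, hfu]
    simp
  · rw [map_add, map_add, map_smul, hxv, hev, hfv]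
    simp
  · simp only [map_add, map_smul, LinearMap.add_apply, LinearMap.smul_apply, hxx, hxe, hxf,
      form_comm e x, form_comm f x, hef.form_left, hef.form_right, hef.form_left_right,
      form_comm f e, smul_eq_mul]
    rcases hα with rfl | rfl <;> rcases hβ with rfl | rfl <;> norm_num at hd ⊢ <;> omega
  · rw [map_add, map_add, map_smul, form_comm f x, hxf, form_comm f e, hef.form_left_right,
      hef.form_right]
    simp

/-! ### Orbits -/

theorem IsGlueVector.orbit_eq {α β d : ℤ} {y y' : I} (h : IsGlueVector α β d y)
    (h' : IsGlueVector α β d y') :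
    MulAction.orbit fixGroup (extendBy y) = MulAction.orbit fixGroup (extendBy y') := by
  obtain ⟨m, hm, hmy⟩ := h.exists_mem
  obtain ⟨m', hm', hmy'⟩ := h'.exists_mem
  obtain ⟨g, hg, hgy⟩ := isHyperbolicQuadruple_isotropic.exists_apply_eq hm hmy hm' hmy'
    (h.form_u.trans h'.form_u.symm) (h.form_v.trans h'.form_v.symm) (by linarith [h.disc, h'.disc])
  obtain ⟨-, hu, hv⟩ := mem_fixGroup_iff.mp hg
  refine (MulAction.orbit_eq_iff.mpr ⟨⟨g, hg⟩, ?_⟩).symm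
  change g • extendBy y = extendBy y'
  rw [smul_extendBy, hu, hv, hgy, extendBy]

/-- If all lattices `K` of discriminant `d` have glue of type `(α, β)`, they form one orbit. -/
theorem orbits_eq_singleton {d : ℕ} (hd : 0 < d) {α β : ℤ} (hα : α = 0 ∨ α = 1)
    (hβ : β = 0 ∨ β = 1) (hdαβ : (d : ℤ) % 8 = 2 * (α + β))
    (h : ∀ K, IsSpecial d K → ∃ y, IsGlueVector α β d y ∧ K = extendBy y) :
    ∃ O, orbits d = {O} := by
  obtain ⟨y, hy⟩ := exists_isGlueVector hα hβ hdαβ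
  refine ⟨MulAction.orbit fixGroup (extendBy y), Set.eq_singleton_iff_unique_mem.mpr
    ⟨⟨_, hy.isSpecial hd, rfl⟩, ?_⟩⟩
  rintro _ ⟨K, hK, rfl⟩
  obtain ⟨y', hy', rfl⟩ := h K hK
  exact hy'.orbit_eq hy

/-- The parity of pairings with `v` is invariant: all are even on `⟨u, v, y⟩`, while `v·y' = 1`. -/
theorem IsGlueVector.orbit_ne {α d : ℤ} {y y' : I} (h : IsGlueVector α 0 d y)
    (h' : IsGlueVector 0 1 d y') :
    MulAction.orbit fixGroup (extendBy y) ≠ MulAction.orbit fixGroup (extendBy y') := by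
  intro h0
  obtain ⟨g, hg⟩ := MulAction.orbit_eq_iff.mp h0.symm
  obtain ⟨-, hu, hv⟩ := mem_fixGroup_iff.mp g.2
  have h1 : y' ∈ (g : I ≃ₗ[ℤ] I) • extendBy y :=
    (show (g : I ≃ₗ[ℤ] I) • extendBy y = extendBy y' from hg) ▸ self_mem_extendBy y'
  rw [smul_extendBy, hu, hv, Submodule.mem_span_triple] at h1
  obtain ⟨a, b, c, habc⟩ := h1
  have h2 := (mem_fixGroup_iff.mp g.2).1 v y
  rw [hv, h.form_v] at h2
  have h3 := h'.form_v
  rw [← habc, map_add, map_add, map_smul, map_smul, map_smul, h2, form_comm v u, form_u_v,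
    form_v_v] at h3
  simp only [smul_eq_mul] at h3
  omega

theorem IsGlueVector.swap {α β d : ℤ} {y : I} (h : IsGlueVector α β d y) {e f : I}
    {r : I ≃ₗ[ℤ] I} (hr : IsRI e f r) : IsGlueVector β α d (r y) := by
  obtain ⟨m, hm, hmy⟩ := h.exists_mem
  have hi := hr.isometry
  have hu : form u (r y) = β := by rw [← hr.map_v, hi, h.form_v]
  have hv : form v (r y) = α := by rw [← hr.map_u, hi, h.form_u]
  refine ⟨hu, hv, ?_, r m, ?_, by rw [hi, hmy]⟩
  · rw [hi, ← h.disc]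
    ring
  · have h1 := hi v m
    have h2 := hi u m
    rw [hr.map_v] at h1
    rw [hr.map_u] at h2
    rw [mem_Lambda_iff, h1, h2]
    exact (mem_Lambda_iff.mp hm).symm

theorem IsRI.smul_extendBy {e f : I} {r : I ≃ₗ[ℤ] I} (hr : IsRI e f r) (y : I) :
    r • extendBy y = extendBy (r y) := by
  rw [GushelMukai.smul_extendBy, hr.map_u, hr.map_v, Set.insert_comm, extendBy]

/-- Swapping `u` and `v`, `r` normalizes the group fixing both, and so permutes its orbits. -/
theorem IsRI.conj_mem {e f : I} {r : I ≃ₗ[ℤ] I} (hr : IsRI e f r) {g : I ≃ₗ[ℤ] I}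
    (hg : g ∈ fixGroup) : r * g * r ∈ fixGroup := by
  obtain ⟨hi, hu, hv⟩ := mem_fixGroup_iff.mp hg
  rw [mem_fixGroup_iff]
  simp only [LinearEquiv.mul_apply]
  refine ⟨fun x y => ?_, by rw [hr.map_u, hv, hr.map_v], by rw [hr.map_v, hu, hr.map_u]⟩
  rw [hr.isometry, hi, hr.isometry]

theorem IsRI.image_orbit {e f : I} {r : I ≃ₗ[ℤ] I} (hr : IsRI e f r) (K : Submodule ℤ I) :
    (fun K => r • K) '' MulAction.orbit fixGroup K = MulAction.orbit fixGroup (r • K) := by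
  ext M
  constructor
  · rintro ⟨_, ⟨g, rfl⟩, rfl⟩
    refine ⟨⟨_, hr.conj_mem g.2⟩, ?_⟩
    change (r * g * r) • r • K = r • (g : I ≃ₗ[ℤ] I) • K
    rw [smul_smul, smul_smul, mul_assoc, hr.involutive, mul_one]
  · rintro ⟨g, rfl⟩
    refine ⟨_, ⟨⟨_, hr.conj_mem g.2⟩, rfl⟩, ?_⟩
    change r • (r * g * r) • K = (g : I ≃ₗ[ℤ] I) • r • K
    rw [smul_smul, smul_smul, ← mul_assoc, ← mul_assoc, hr.involutive, one_mul]

theorem image_orbit_eq {α β d : ℤ} {y y' : I} (h : IsGlueVector α β d y)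
    (h' : IsGlueVector β α d y') {e f : I} {r : I ≃ₗ[ℤ] I} (hr : IsRI e f r) :
    (fun K => r • K) '' MulAction.orbit fixGroup (extendBy y) =
      MulAction.orbit fixGroup (extendBy y') := by
  rw [hr.image_orbit, hr.smul_extendBy, (h.swap hr).orbit_eq h']

theorem orbits_eq_pair {d : ℕ} (hd : 0 < d) (hd2 : (d : ℤ) % 8 = 2)
    (h : ∀ K, IsSpecial d K →
      ∃ y, (IsGlueVector 1 0 d y ∨ IsGlueVector 0 1 d y) ∧ K = extendBy y) :
    ∃ O₁ O₂, O₁ ≠ O₂ ∧ orbits d = {O₁, O₂} ∧ ∀ (e f : I) (r : I ≃ₗ[ℤ] I),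
      IsA1Pair e f → IsRI e f r → (fun K => r • K) '' O₁ = O₂ ∧ (fun K => r • K) '' O₂ = O₁ := by
  obtain ⟨y, hy⟩ := exists_isGlueVector (α := 1) (β := 0) (d := d) (by simp) (by simp) (by omega)
  obtain ⟨y', hy'⟩ := exists_isGlueVector (α := 0) (β := 1) (d := d) (by simp) (by simp) (by omega)
  refine ⟨_, _, hy.orbit_ne hy', Set.Subset.antisymm ?_ ?_, fun e f r _ hr =>
    ⟨image_orbit_eq hy hy' hr, image_orbit_eq hy' hy hr⟩⟩
  · rintro _ ⟨K, hK, rfl⟩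
    obtain ⟨z, hz | hz, rfl⟩ := h K hK
    · exact Or.inl (hz.orbit_eq hy)
    · exact Or.inr (hz.orbit_eq hy')
  · rintro _ (rfl | rfl)
    · exact ⟨_, hy.isSpecial hd, rfl⟩
    · exact ⟨_, hy'.isSpecial hd, rfl⟩

end GushelMukai

theorem proposition5p3 :
    -- restriction to `Λ` identifies `{g ∈ O(I_{22,2}) | g|_{Λ₂} = Id}` with `Õ(Λ)`
    (Function.Injective GushelMukai.restrictLambda ∧
      GushelMukai.restrictLambda.range =
        GushelMukai.stableOrthogonalGroup GushelMukai.formLambda) ∧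
    -- the involution `r_I` makes sense
    ((∃ e f : GushelMukai.I, GushelMukai.IsA1Pair e f) ∧
      ∀ e f : GushelMukai.I, GushelMukai.IsA1Pair e f →
        ∃! r : GushelMukai.I ≃ₗ[ℤ] GushelMukai.I, GushelMukai.IsRI e f r) ∧
    ∀ d : ℕ, 0 < d →
      (d % 8 = 0 →
        (∃ O, GushelMukai.orbits d = {O}) ∧
        ∀ K, GushelMukai.IsSpecial d K →
          GushelMukai.HasGramMatrix (GushelMukai.form.restrict K)
            !![2, 0, 0; 0, 2, 0; 0, 0, (d : ℤ) / 4]) ∧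
      (d % 8 = 2 →
        (∃ O₁ O₂, O₁ ≠ O₂ ∧ GushelMukai.orbits d = {O₁, O₂} ∧
          ∀ (e f : GushelMukai.I) (r : GushelMukai.I ≃ₗ[ℤ] GushelMukai.I),
            GushelMukai.IsA1Pair e f → GushelMukai.IsRI e f r →
              (fun K => r • K) '' O₁ = O₂ ∧ (fun K => r • K) '' O₂ = O₁) ∧
        ∀ K, GushelMukai.IsSpecial d K →
          GushelMukai.HasGramMatrix (GushelMukai.form.restrict K)
            !![2, 0, 0; 0, 2, 1; 0, 1, ((d : ℤ) + 2) / 4]) ∧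
      (d % 8 = 4 →
        (∃ O, GushelMukai.orbits d = {O}) ∧
        ∀ K, GushelMukai.IsSpecial d K →
          GushelMukai.HasGramMatrix (GushelMukai.form.restrict K)
            !![2, 0, 1; 0, 2, 1; 1, 1, ((d : ℤ) + 4) / 4]) := by
  refine ⟨⟨GushelMukai.restrictLambda_injective, GushelMukai.restrictLambda_range⟩,
    ⟨⟨_, _, GushelMukai.isA1Pair_eVec⟩, fun e f h => ?_⟩, fun d hd => ?_⟩
  · obtain ⟨r, hr⟩ := h.exists_isRI
    exact ⟨r, hr, fun s hs => h.isRI_unique hs hr⟩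
  refine ⟨fun hd8 => ?_, fun hd8 => ?_, fun hd8 => ?_⟩
  · have key : ∀ K, GushelMukai.IsSpecial d K →
        ∃ y, GushelMukai.IsGlueVector 0 0 d y ∧ K = GushelMukai.extendBy y := fun K hK => by
      obtain ⟨α, β, y, hα, hβ, hy, rfl⟩ := hK.exists_isGlueVector
      obtain ⟨rfl, rfl⟩ : α = 0 ∧ β = 0 := by
        have := hy.emod_eight hα hβ
        omega
      exact ⟨y, hy, rfl⟩
    refine ⟨GushelMukai.orbits_eq_singleton hd (by simp) (by simp) (by omega) key, fun K hK => ?_⟩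
    obtain ⟨y, hy, rfl⟩ := key K hK
    have h := hy.hasGramMatrix
    rwa [show GushelMukai.form y y = (d : ℤ) / 4 by have := hy.disc; omega] at h
  · have key : ∀ K, GushelMukai.IsSpecial d K →
        ∃ y, (GushelMukai.IsGlueVector 1 0 d y ∨ GushelMukai.IsGlueVector 0 1 d y) ∧
          K = GushelMukai.extendBy y := fun K hK => by
      obtain ⟨α, β, y, hα, hβ, hy, rfl⟩ := hK.exists_isGlueVector
      obtain ⟨rfl, rfl⟩ | ⟨rfl, rfl⟩ : α = 1 ∧ β = 0 ∨ α = 0 ∧ β = 1 := by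
        have := hy.emod_eight hα hβ
        omega
      · exact ⟨y, Or.inl hy, rfl⟩
      · exact ⟨y, Or.inr hy, rfl⟩
    refine ⟨GushelMukai.orbits_eq_pair hd (by omega) key, fun K hK => ?_⟩
    obtain ⟨y, hy | hy, rfl⟩ := key K hK
    -- For glue `(1, 0)` the basis `v, u, y` gives the same matrix as `u, v, y` does for `(0, 1)`.
    · have h := hy.hasGramMatrix_swap
      rwa [show GushelMukai.form y y = ((d : ℤ) + 2) / 4 by have := hy.disc; omega] at h
    · have h := hy.hasGramMatrix
      rwa [show GushelMukai.form y y = ((d : ℤ) + 2) / 4 by have := hy.disc; omega] at h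
  · have key : ∀ K, GushelMukai.IsSpecial d K →
        ∃ y, GushelMukai.IsGlueVector 1 1 d y ∧ K = GushelMukai.extendBy y := fun K hK => by
      obtain ⟨α, β, y, hα, hβ, hy, rfl⟩ := hK.exists_isGlueVector
      obtain ⟨rfl, rfl⟩ : α = 1 ∧ β = 1 := by
        have := hy.emod_eight hα hβ
        omega
      exact ⟨y, hy, rfl⟩
    refine ⟨GushelMukai.orbits_eq_singleton hd (by simp) (by simp) (by omega) key, fun K hK => ?_⟩
    obtain ⟨y, hy, rfl⟩ := key K hK
    have h := hy.hasGramMatrix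
    rwa [show GushelMukai.form y y = ((d : ℤ) + 4) / 4 by have := hy.disc; omega] at h
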